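/- Monadic second order (MSO) formulae about graphs are built from vertex variables $x,y,\dots$, variables $X,Y,\dots$ for sets of vertices, the atomic formulae $x\sim y$ (adjacency), $x=y$ and $X(x)$ (membership), the connectives $\neg,\wedge,\vee,\rightarrow,\leftrightarrow$, and the quantifiers $\forall,\exists$ over vertices and over sets of vertices. The quantifier depth $\mathrm{q}(\varphi)$ is the number of quantifiers (of both kinds) in a longest sequence of nested quantifiers of $\varphi$. For $\alpha>0$, let $G(n,n^{-\alpha})$ be the random graph on $n$ labelled vertices in which every pair of vertices is joined by an edge with probability $n^{-\alpha}$, independently of the other pairs. The spectrum $\mathcal S(\varphi)$ of an MSO sentence $\varphi$ is the set of all $\alpha>0$ for which it is not true that $\lim_{n\to\infty}\mathsf P(G(n,n^{-\alpha})\models\varphi)$ exists and equals $0$ or $1$. **Theorem.** There exists an MSO sentence $\varphi$ with $\mathrm{q}(\varphi)=4$ whose spectrum $\mathcal S(\varphi)$ is infinite; moreover, $\varphi$ can be chosen so that $$\frac12+\frac1{2(m+1)}\in\mathcal S(\varphi)\qquad\text{for every integer } m\ge 2 .$$ -/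

import Mathlib

open Filter Topology

/-- Monadic second order formulae in the language of graphs, with `k` free vertex variables
(indexed by `Fin k`) and `l` free set variables (indexed by `Fin l`). A quantifier binds the
variable with the last index. -/
inductive MSOFormula : ℕ → ℕ → Type
  /-- `x_i ∼ x_j` -/
  | adj {k l : ℕ} (i j : Fin k) : MSOFormula k l
  /-- `x_i = x_j` -/
  | eq {k l : ℕ} (i j : Fin k) : MSOFormula k l
  /-- `X_a(x_i)` -/
  | mem {k l : ℕ} (a : Fin l) (i : Fin k) : MSOFormula k l
  | not {k l : ℕ} (φ : MSOFormula k l) : MSOFormula k l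
  | and {k l : ℕ} (φ ψ : MSOFormula k l) : MSOFormula k l
  | or {k l : ℕ} (φ ψ : MSOFormula k l) : MSOFormula k l
  | imp {k l : ℕ} (φ ψ : MSOFormula k l) : MSOFormula k l
  | iff {k l : ℕ} (φ ψ : MSOFormula k l) : MSOFormula k l
  /-- universal quantifier over vertices -/
  | all {k l : ℕ} (φ : MSOFormula (k + 1) l) : MSOFormula k l
  /-- existential quantifier over vertices -/
  | ex {k l : ℕ} (φ : MSOFormula (k + 1) l) : MSOFormula k l
  /-- universal quantifier over sets of vertices -/
  | allSet {k l : ℕ} (φ : MSOFormula k (l + 1)) : MSOFormula k l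
  /-- existential quantifier over sets of vertices -/
  | exSet {k l : ℕ} (φ : MSOFormula k (l + 1)) : MSOFormula k l

namespace MSOFormula

/-- The quantifier depth: the largest number of nested quantifiers, over vertices or over sets. -/
def quantifierDepth : {k l : ℕ} → MSOFormula k l → ℕ
  | _, _, adj _ _ => 0
  | _, _, eq _ _ => 0
  | _, _, mem _ _ => 0
  | _, _, not φ => φ.quantifierDepth
  | _, _, and φ ψ => max φ.quantifierDepth ψ.quantifierDepth
  | _, _, or φ ψ => max φ.quantifierDepth ψ.quantifierDepth
  | _, _, imp φ ψ => max φ.quantifierDepth ψ.quantifierDepth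
  | _, _, iff φ ψ => max φ.quantifierDepth ψ.quantifierDepth
  | _, _, all φ => φ.quantifierDepth + 1
  | _, _, ex φ => φ.quantifierDepth + 1
  | _, _, allSet φ => φ.quantifierDepth + 1
  | _, _, exSet φ => φ.quantifierDepth + 1

/-- Truth of a formula in the graph `G`, where `x` interprets the free vertex variables and `X`
the free set variables. -/
def Realize {V : Type*} (G : SimpleGraph V) :
    {k l : ℕ} → MSOFormula k l → (Fin k → V) → (Fin l → Set V) → Prop
  | _, _, adj i j, x, _ => G.Adj (x i) (x j)
  | _, _, eq i j, x, _ => x i = x j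
  | _, _, mem a i, x, X => x i ∈ X a
  | _, _, not φ, x, X => ¬ φ.Realize G x X
  | _, _, and φ ψ, x, X => φ.Realize G x X ∧ ψ.Realize G x X
  | _, _, or φ ψ, x, X => φ.Realize G x X ∨ ψ.Realize G x X
  | _, _, imp φ ψ, x, X => φ.Realize G x X → ψ.Realize G x X
  | _, _, iff φ ψ, x, X => φ.Realize G x X ↔ ψ.Realize G x X
  | _, _, all φ, x, X => ∀ v : V, φ.Realize G (Fin.snoc (α := fun _ => V) x v) X
  | _, _, ex φ, x, X => ∃ v : V, φ.Realize G (Fin.snoc (α := fun _ => V) x v) X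
  | _, _, allSet φ, x, X => ∀ S : Set V, φ.Realize G x (Fin.snoc (α := fun _ => Set V) X S)
  | _, _, exSet φ, x, X => ∃ S : Set V, φ.Realize G x (Fin.snoc (α := fun _ => Set V) X S)

end MSOFormula

/-- MSO sentences: formulae without free variables. -/
abbrev MSOSentence : Type := MSOFormula 0 0

/-- `G ⊨ φ` for an MSO sentence `φ`. -/
def SimpleGraph.Models {V : Type*} (G : SimpleGraph V) (φ : MSOSentence) : Prop :=
  φ.Realize G Fin.elim0 Fin.elim0

/-- The edge probability `n ^ (-α)`, as an element of `[0, 1]`. -/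
noncomputable def edgeProb (α : ℝ) (n : ℕ) : unitInterval :=
  Set.projIcc (0 : ℝ) 1 zero_le_one ((n : ℝ) ^ (-α))

/-- For `α > 0` the truncation in `edgeProb` does nothing. -/
theorem coe_edgeProb {α : ℝ} (hα : 0 < α) (n : ℕ) : (edgeProb α n : ℝ) = (n : ℝ) ^ (-α) := by
  have h0 : (0 : ℝ) ≤ (n : ℝ) ^ (-α) := Real.rpow_nonneg (Nat.cast_nonneg n) _
  have h1 : (n : ℝ) ^ (-α) ≤ 1 := by
    rcases Nat.eq_zero_or_pos n with rfl | hn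
    · rw [Nat.cast_zero, Real.zero_rpow (by linarith)]
      exact zero_le_one
    · exact Real.rpow_le_one_of_one_le_of_nonpos (by exact_mod_cast hn) (by linarith)
  rw [edgeProb, Set.projIcc_of_mem zero_le_one ⟨h0, h1⟩]

/-- The probability that the binomial random graph `G(n, n ^ (-α))` satisfies `φ`. -/
noncomputable def MSOFormula.prob (φ : MSOSentence) (α : ℝ) (n : ℕ) : ℝ :=
  (SimpleGraph.binomialRandom (Fin n) (edgeProb α n)).real {G | G.Models φ}

/-- The spectrum of `φ`: all `α > 0` for which it is not the case that the limit of
`P(G(n, n ^ (-α)) ⊨ φ)` exists and equals `0` or `1`. -/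
def MSOFormula.spectrum (φ : MSOSentence) : Set ℝ :=
  {α | 0 < α ∧ ¬ (Tendsto (φ.prob α) atTop (𝓝 0) ∨ Tendsto (φ.prob α) atTop (𝓝 1))}

/-! Write m = k + 2, n = z^(2m+2) and p = n^(-α) for α = 1/2 + 1/(2(m+1)). Then p = z^(-(m+2)), np =
z^m and np² = z^(-2).

The fan graph has m + 2 vertices and 2(m + 1) edges, so α is exactly vertices over edges: at this
density the expected number of copies is of order 1. A fan set with at least m + 1 elements yields a
copy, with the common neighbour and the dominating element as hubs. On the other hand, a fixed set
of s elements has about n(np²)^s = z^(2m+2-2s) vertices `v` joined to all its elements by paths of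
length 2. This is at least z² for s ≤ m and of order 1 for s = m + 1. Both transitions meet at size
m + 1, and one sentence serves all m because the size is never mentioned. The last clause of
`IsCentered` discards the neighbours of a common neighbour of `X`, which would be centres for a
trivial reason.

Upper bound (`expect_exists_isFanSet_le`): with probability tending to 1 every set of 2 to m
elements is centered, by exposing the edges in two rounds and a union bound. A larger fan set forces
a copy of the fan graph, which has probability at most 1/2: the expected number of embeddings is at
most 1, and exchanging the hubs makes embeddings come in pairs (`expect_exists_copy_le`).

Lower bound (`expect_exists_isFanSet_ge`): let Z count the embedded copies without a detour, that
is, without a centre for the vertices other than the first hub. A detour shares no edge with the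
copy, so the two events are independent. The Harris inequality bounds the probability of no detour
from below, hence E Z from below. The fan graph is sparse enough for E Z² to be bounded, and
Cauchy–Schwarz bounds P(Z > 0) away from 0.

So the probability can tend neither to 0 nor to 1. -/

/-- `X` has a common neighbour, has an element adjacent to all its other elements, and contains a
triangle. -/
def SimpleGraph.IsFanSet {V : Type*} (G : SimpleGraph V) (X : Set V) : Prop :=
  (∃ y, ∀ u, u ∈ X → G.Adj y u) ∧ (∃ x, x ∈ X ∧ ∀ u, u ∈ X → (u = x ∨ G.Adj x u)) ∧
    ∃ a b c, a ∈ X ∧ b ∈ X ∧ c ∈ X ∧ G.Adj a b ∧ G.Adj a c ∧ G.Adj b c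

/-- Some vertex `v`, none of whose neighbours is adjacent to all of `X`, has a common neighbour
outside `X` with every element of `X`. -/
def SimpleGraph.IsCentered {V : Type*} (G : SimpleGraph V) (X : Set V) : Prop :=
  ∃ v, (∀ u, u ∈ X → ∃ w, w ∉ X ∧ G.Adj w u ∧ G.Adj w v) ∧
    ¬ ∃ w, G.Adj w v ∧ ∀ u, u ∈ X → G.Adj w u

/-! ### The sentence and its quantifier depth. -/

namespace MSOFormula

/-- There is a set satisfying `IsFanSet` but not `IsCentered`. -/
def fanSentence : MSOSentence :=
  .exSet (.and
    (.and (.ex (.all (.imp (.mem 0 1) (.adj 0 1))))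
      (.and (.ex (.and (.mem 0 0) (.all (.imp (.mem 0 1) (.or (.eq 1 0) (.adj 0 1))))))
        (.ex (.ex (.ex (.and (.mem 0 0) (.and (.mem 0 1) (.and (.mem 0 2)
          (.and (.adj 0 1) (.and (.adj 0 2) (.adj 1 2)))))))))))
    (.not (.ex (.and
      (.all (.imp (.mem 0 1) (.ex (.and (.not (.mem 0 2)) (.and (.adj 2 1) (.adj 2 0))))))
      (.not (.ex (.and (.adj 1 0) (.all (.imp (.mem 0 2) (.adj 1 2))))))))))

theorem quantifierDepth_fanSentence : fanSentence.quantifierDepth = 4 := by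
  simp [fanSentence, quantifierDepth]

theorem models_fanSentence {V : Type*} (G : SimpleGraph V) :
    G.Models fanSentence ↔ ∃ X : Set V, G.IsFanSet X ∧ ¬ G.IsCentered X := by
  simp [SimpleGraph.Models, fanSentence, Realize, SimpleGraph.IsFanSet, SimpleGraph.IsCentered,
    Fin.snoc]

end MSOFormula

/-! ### Random subsets with independent elements: expectation, independence, Harris inequality. -/

namespace BernoulliSum

open Finset

set_option linter.unusedSectionVars false

variable {E : Type*} [Fintype E] [DecidableEq E]

/-- The probability that the random subset of `E` containing each `e` independently with
probability `q e` is `S`. -/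
def weight (q : E → ℝ) (S : Finset E) : ℝ := ∏ e, if e ∈ S then q e else 1 - q e

/-- The expectation of `f` at the random subset of `E` containing each `e` independently with
probability `q e`. -/
def expect (q : E → ℝ) (f : Finset E → ℝ) : ℝ := ∑ S, weight q S * f S

/-- `f S` depends only on `S ∩ A`. -/
def DependsOn (f : Finset E → ℝ) (A : Finset E) : Prop := ∀ S T, S ∩ A = T ∩ A → f S = f T

/-- Expanding the product of sums over subsets gives the expectation of a product of one-coordinate
factors; total mass 1 and the moment formulas below are special cases. -/
theorem expect_prod_ite (q a b : E → ℝ) :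
    expect q (fun S => ∏ e, if e ∈ S then a e else b e) = ∏ e, (q e * a e + (1 - q e) * b e) := by
  rw [Finset.prod_add, Finset.powerset_univ]
  unfold expect weight
  refine Finset.sum_congr rfl fun S _ => ?_
  rw [← Finset.prod_mul_distrib, ← Finset.prod_sdiff (Finset.subset_univ S), mul_comm]
  congr 1
  · refine Finset.prod_congr rfl fun e he => ?_
    simp [he]
  · refine Finset.prod_congr rfl fun e he => ?_
    simp [(Finset.mem_sdiff.1 he).2]

theorem expect_const (q : E → ℝ) (c : ℝ) : expect q (fun _ => c) = c := by
  have h := expect_prod_ite q 1 1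
  simp only [Pi.one_apply, ite_self, Finset.prod_const_one, mul_one, add_sub_cancel] at h
  unfold expect at h ⊢
  rw [← Finset.sum_mul, mul_one] at h
  rw [← Finset.sum_mul, h, one_mul]

theorem weight_nonneg {q : E → ℝ} (h0 : ∀ e, 0 ≤ q e) (h1 : ∀ e, q e ≤ 1) (S : Finset E) :
    0 ≤ weight q S :=
  Finset.prod_nonneg fun e _ => by split_ifs <;> linarith [h0 e, h1 e]

theorem expect_add (q : E → ℝ) (f g : Finset E → ℝ) :
    expect q (fun S => f S + g S) = expect q f + expect q g := by
  simp [expect, mul_add, Finset.sum_add_distrib]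

theorem expect_sub (q : E → ℝ) (f g : Finset E → ℝ) :
    expect q (fun S => f S - g S) = expect q f - expect q g := by
  simp [expect, mul_sub, Finset.sum_sub_distrib]

theorem expect_const_mul (q : E → ℝ) (c : ℝ) (f : Finset E → ℝ) :
    expect q (fun S => c * f S) = c * expect q f := by
  simp only [expect, Finset.mul_sum]
  exact Finset.sum_congr rfl fun S _ => by ring

theorem expect_sum {ι : Type*} (q : E → ℝ) (s : Finset ι) (f : ι → Finset E → ℝ) :
    expect q (fun S => ∑ i ∈ s, f i S) = ∑ i ∈ s, expect q (f i) := by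
  simp only [expect, Finset.mul_sum]
  rw [Finset.sum_comm]

theorem expect_mono {q : E → ℝ} {f g : Finset E → ℝ} (h0 : ∀ e, 0 ≤ q e) (h1 : ∀ e, q e ≤ 1)
    (h : ∀ S, f S ≤ g S) : expect q f ≤ expect q g :=
  Finset.sum_le_sum fun S _ => mul_le_mul_of_nonneg_left (h S) (weight_nonneg h0 h1 S)

theorem expect_nonneg {q : E → ℝ} {f : Finset E → ℝ} (h0 : ∀ e, 0 ≤ q e) (h1 : ∀ e, q e ≤ 1)
    (h : ∀ S, 0 ≤ f S) : 0 ≤ expect q f :=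
  Finset.sum_nonneg fun S _ => mul_nonneg (weight_nonneg h0 h1 S) (h S)

theorem expect_mul_sq_le {q : E → ℝ} (h0 : ∀ e, 0 ≤ q e) (h1 : ∀ e, q e ≤ 1) (f g : Finset E → ℝ) :
    expect q (fun S => f S * g S) ^ 2 ≤
      expect q (fun S => f S ^ 2) * expect q (fun S => g S ^ 2) := by
  have h := Finset.sum_mul_sq_le_sq_mul_sq Finset.univ
    (fun S => √(weight q S) * f S) (fun S => √(weight q S) * g S)
  have hs : ∀ S, √(weight q S) ^ 2 = weight q S := fun S => Real.sq_sqrt (weight_nonneg h0 h1 S)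
  calc _ = (∑ S, √(weight q S) * f S * (√(weight q S) * g S)) ^ 2 := by
        unfold expect
        congr 1
        refine Finset.sum_congr rfl fun S _ => ?_
        linear_combination (-(f S * g S)) * hs S
    _ ≤ _ := h
    _ = _ := by simp only [mul_pow, hs, expect]

/-- Resampling the elements outside `A` does not change the expectation. -/
theorem expect_resample (q : E → ℝ) (A : Finset E) (f : Finset E → ℝ) :
    expect q f = expect q (fun S => expect q (fun T => f ((S ∩ A) ∪ (T \ A)))) := by
  -- For two independent copies, exchanging their parts outside `A` is an involution that preserves
  -- the product weight.
  let σ : Finset E × Finset E → Finset E × Finset E :=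
    fun x => ((x.1 ∩ A) ∪ (x.2 \ A), (x.2 ∩ A) ∪ (x.1 \ A))
  have hσ : Function.Involutive σ := by
    rintro ⟨S, T⟩
    ext e <;> simp only [σ, mem_union, mem_inter, Finset.mem_sdiff] <;> tauto
  have hw : ∀ x, weight q (σ x).1 * weight q (σ x).2 = weight q x.1 * weight q x.2 := by
    rintro ⟨S, T⟩
    unfold weight
    rw [← Finset.prod_mul_distrib, ← Finset.prod_mul_distrib]
    refine Finset.prod_congr rfl fun e _ => ?_
    by_cases hA : e ∈ A <;> by_cases hS : e ∈ S <;> by_cases hT : e ∈ T <;>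
      simp [σ, hA, hS, hT, mul_comm]
  have hr : expect q (fun S => expect q (fun T => f ((S ∩ A) ∪ (T \ A)))) =
      ∑ x : Finset E × Finset E, weight q x.1 * weight q x.2 * f (σ x).1 := by
    rw [Fintype.sum_prod_type]
    simp only [expect, Finset.mul_sum, σ, mul_assoc]
  rw [hr, ← Equiv.sum_comp (hσ.toPerm σ)]
  simp only [Function.Involutive.coe_toPerm, hw, hσ _]
  rw [Fintype.sum_prod_type]
  have h1 := expect_const q 1
  simp only [expect, mul_one] at h1
  simp only [expect]
  refine Finset.sum_congr rfl fun S _ => ?_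
  simp_rw [mul_right_comm _ _ (f S)]
  rw [← Finset.mul_sum, h1, mul_one]

theorem DependsOn.mono {f : Finset E → ℝ} {A B : Finset E} (h : DependsOn f A) (hAB : A ⊆ B) :
    DependsOn f B := fun S T hST => h S T <| by
  rw [← Finset.inter_eq_right.2 hAB, ← Finset.inter_assoc, ← Finset.inter_assoc, hST]

theorem dependsOn_of_iff {A : Finset E} {P : Finset E → Prop} [DecidablePred P] {a b : ℝ}
    (h : ∀ S T, S ∩ A = T ∩ A → P S → P T) : DependsOn (fun S => if P S then a else b) A := by
  intro S T hST
  have : P S ↔ P T := ⟨h S T hST, h T S hST.symm⟩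
  simp [this]

theorem mem_iff_of_inter_eq {A S T : Finset E} (h : S ∩ A = T ∩ A) {e : E} (he : e ∈ A) :
    e ∈ S ↔ e ∈ T := by
  have := Finset.ext_iff.1 h e
  simpa [he] using this

theorem dependsOn_prod {ι : Type*} {s : Finset ι} {f : ι → Finset E → ℝ} {A : Finset E}
    (h : ∀ i ∈ s, DependsOn (f i) A) : DependsOn (fun S => ∏ i ∈ s, f i S) A :=
  fun S T hST => Finset.prod_congr rfl fun i hi => h i hi S T hST

/-- Functions of disjoint sets of coordinates are independent: after resampling outside `A`, `f`
sees only the first copy and `g` only the second. -/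
theorem expect_mul {q : E → ℝ} {f g : Finset E → ℝ} {A B : Finset E} (hf : DependsOn f A)
    (hg : DependsOn g B) (hAB : Disjoint A B) :
    expect q (fun S => f S * g S) = expect q f * expect q g := by
  rw [expect_resample q A]
  have h : ∀ S T, f ((S ∩ A) ∪ (T \ A)) * g ((S ∩ A) ∪ (T \ A)) = f S * g T := by
    intro S T
    rw [hf _ S, hg _ T]
    · ext e
      have : e ∈ B → e ∉ A := fun h => Finset.disjoint_right.1 hAB h
      simp only [mem_union, mem_inter, Finset.mem_sdiff]
      tauto
    · ext e
      simp only [mem_union, mem_inter, Finset.mem_sdiff]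
      tauto
  simp only [h, expect_const_mul]
  simp only [mul_comm _ (expect q g), expect_const_mul]

theorem expect_prod {ι : Type*} [DecidableEq ι] {q : E → ℝ} (s : Finset ι)
    {f : ι → Finset E → ℝ} {A : ι → Finset E} (hf : ∀ i ∈ s, DependsOn (f i) (A i))
    (hA : (s : Set ι).PairwiseDisjoint A) :
    expect q (fun S => ∏ i ∈ s, f i S) = ∏ i ∈ s, expect q (f i) := by
  induction s using Finset.induction_on with
  | empty => simp [expect_const]
  | insert i s hi ih =>
    simp only [Finset.prod_insert hi]
    rw [expect_mul (A := A i) (B := s.biUnion A) (hf i (mem_insert_self i s)), ih]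
    · exact fun j hj => hf j (mem_insert_of_mem hj)
    · exact hA.subset (by simp)
    · exact dependsOn_prod fun j hj =>
        (hf j (mem_insert_of_mem hj)).mono (Finset.subset_biUnion_of_mem A hj)
    · rw [Finset.disjoint_biUnion_right]
      intro j hj
      exact hA (by simp) (by simp [hj]) (fun h => hi (h ▸ hj))

theorem expect_subset_disjoint (q : E → ℝ) {F H : Finset E} (hFH : Disjoint F H) :
    expect q (fun S => if F ⊆ S ∧ Disjoint H S then 1 else 0) =
      (∏ e ∈ F, q e) * ∏ e ∈ H, (1 - q e) := by
  have h : ∀ S : Finset E, (if F ⊆ S ∧ Disjoint H S then (1 : ℝ) else 0) =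
      ∏ e, if e ∈ S then (if e ∈ H then 0 else 1) else (if e ∈ F then 0 else 1) := by
    intro S
    split_ifs with hS
    · refine (Finset.prod_eq_one fun e _ => ?_).symm
      by_cases he : e ∈ S
      · simp [he, Finset.disjoint_right.1 hS.2 he]
      · have : e ∉ F := fun h => he (hS.1 h)
        simp [he, this]
    · symm
      rw [not_and_or] at hS
      rcases hS with hS | hS
      · obtain ⟨e, he, heS⟩ := Finset.not_subset.1 hS
        exact Finset.prod_eq_zero (mem_univ e) (by simp [he, heS])
      · obtain ⟨e, he, heS⟩ := Finset.not_disjoint_iff.1 hS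
        exact Finset.prod_eq_zero (mem_univ e) (by simp [he, heS])
  simp only [h]
  rw [expect_prod_ite, ← Finset.prod_subset (Finset.subset_univ (F ∪ H))]
  · rw [Finset.prod_union hFH]
    congr 1
    · refine Finset.prod_congr rfl fun e he => ?_
      simp [he, Finset.disjoint_left.1 hFH he]
    · refine Finset.prod_congr rfl fun e he => ?_
      simp [he, Finset.disjoint_right.1 hFH he]
  · intro e _ he
    simp only [mem_union, not_or] at he
    simp [he.1, he.2]

theorem expect_subset (q : E → ℝ) (F : Finset E) :
    expect q (fun S => if F ⊆ S then 1 else 0) = ∏ e ∈ F, q e := by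
  simpa using expect_subset_disjoint q (disjoint_empty_right F)

theorem expect_disjoint (q : E → ℝ) (H : Finset E) :
    expect q (fun S => if Disjoint H S then 1 else 0) = ∏ e ∈ H, (1 - q e) := by
  simpa using expect_subset_disjoint q (disjoint_empty_left H)

/-- An instance of the FKG inequality: for a product weight the lattice condition holds with
equality, coordinate by coordinate. -/
theorem expect_le_mul_of_monotone {q : E → ℝ} (h0 : ∀ e, 0 ≤ q e) (h1 : ∀ e, q e ≤ 1)
    {f g : Finset E → ℝ} (hf0 : 0 ≤ f) (hg0 : 0 ≤ g) (hf : Monotone f) (hg : Monotone g) :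
    expect q f * expect q g ≤ expect q (fun S => f S * g S) := by
  have h := fkg (μ := weight q) (f := f) (g := g) (fun S => weight_nonneg h0 h1 S) hf0 hg0 hf hg ?_
  · have e1 := expect_const q 1
    simp only [expect, mul_one] at e1
    rwa [e1, one_mul] at h
  · intro a b
    unfold weight
    rw [← Finset.prod_mul_distrib, ← Finset.prod_mul_distrib]
    refine le_of_eq (Finset.prod_congr rfl fun e _ => ?_)
    by_cases ha : e ∈ a <;> by_cases hb : e ∈ b <;> simp [ha, hb, mul_comm]

/-- The Harris inequality for the event that none of the sets `F i` is contained in the random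
set. -/
theorem prod_le_expect_forall_not_subset {ι : Type*} [DecidableEq ι] {q : E → ℝ}
    (h0 : ∀ e, 0 ≤ q e) (h1 : ∀ e, q e ≤ 1) (s : Finset ι) (F : ι → Finset E) :
    ∏ i ∈ s, (1 - ∏ e ∈ F i, q e) ≤
      expect q (fun S => if ∀ i ∈ s, ¬ F i ⊆ S then 1 else 0) := by
  induction s using Finset.induction_on with
  | empty => simp [expect_const]
  | insert i s hi ih =>
    rw [Finset.prod_insert hi]
    set f : Finset E → ℝ := fun S => if ∀ i ∈ s, ¬ F i ⊆ S then 1 else 0 with hf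
    set g : Finset E → ℝ := fun S => if F i ⊆ S then 1 else 0 with hg
    have hgm : Monotone g := by
      intro S T hST
      simp only [hg]
      split_ifs with a b <;> try norm_num
      exact b (a.trans hST)
    -- FKG is applied to increasing functions, so the decreasing indicator `f` enters through its
    -- complement.
    have hfm : Monotone (fun S => 1 - f S) := by
      intro S T hST
      simp only [hf]
      by_cases a : ∀ i ∈ s, ¬ F i ⊆ T
      · have b : ∀ i ∈ s, ¬ F i ⊆ S := fun i hi h => a i hi (h.trans hST)
        simp only [if_pos a, if_pos b, le_refl]
      · rw [if_neg a]
        split_ifs <;> norm_num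
    have hk := expect_le_mul_of_monotone h0 h1 (f := fun S => 1 - f S) (g := g)
      (fun S => by simp only [hf, Pi.zero_apply]; split_ifs <;> norm_num)
      (fun S => by simp only [hg, Pi.zero_apply]; split_ifs <;> norm_num) hfm hgm
    have hfi : (fun S => if ∀ j ∈ insert i s, ¬ F j ⊆ S then (1 : ℝ) else 0) =
        fun S => f S - (g S - (1 - f S) * g S) := by
      funext S
      simp only [hf, hg, forall_mem_insert]
      by_cases a : ∀ j ∈ s, ¬ F j ⊆ S <;> by_cases b : F i ⊆ S <;> simp [a, b]
    rw [hfi, expect_sub, expect_sub]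
    rw [expect_sub, expect_const] at hk
    have hgE : expect q g = ∏ e ∈ F i, q e := expect_subset q (F i)
    rw [hgE] at hk ⊢
    have hp : 0 ≤ 1 - ∏ e ∈ F i, q e :=
      sub_nonneg.2 (Finset.prod_le_one (fun e _ => h0 e) fun e _ => h1 e)
    nlinarith [mul_le_mul_of_nonneg_left ih hp]

end BernoulliSum

/-! ### The binomial random graph as a random set of pairs. -/

namespace BernoulliSum

open Finset

set_option linter.unusedSectionVars false

variable {V : Type*} [Fintype V] [DecidableEq V]

/-- The probability of each potential edge; loops have probability `0`. -/
def edgeWeight (V : Type*) [DecidableEq V] (p : ℝ) (e : Sym2 V) : ℝ := if e.IsDiag then 0 else p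

theorem edgeWeight_nonneg {p : ℝ} (hp : 0 ≤ p) (e : Sym2 V) : 0 ≤ edgeWeight V p e := by
  unfold edgeWeight; split_ifs <;> linarith

theorem edgeWeight_le {p : ℝ} (hp : 0 ≤ p) (e : Sym2 V) : edgeWeight V p e ≤ p := by
  unfold edgeWeight; split_ifs <;> linarith

theorem edgeWeight_mk {p : ℝ} {u v : V} (h : u ≠ v) : edgeWeight V p s(u, v) = p := by
  simp [edgeWeight, h]

-- Giving loops probability 0 lets the random set range over all of `Sym2 V`; sets containing a loop
-- have weight 0 on both sides.
open ProbabilityTheory in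
theorem weight_edgeWeight (p : unitInterval) (S : Finset (Sym2 V)) :
    weight (edgeWeight V p) S =
      (setBernoulli (Sym2.diagSet (α := V))ᶜ p).real {(S : Set (Sym2 V))} := by
  by_cases hS : (S : Set (Sym2 V)) ⊆ (Sym2.diagSet)ᶜ
  · rw [setBernoulli_real_singleton p hS (Set.toFinite _)]
    unfold weight
    have h : ∀ e : Sym2 V, (if e ∈ S then edgeWeight V p e else 1 - edgeWeight V p e) =
        (if e ∈ S then (p : ℝ) else 1) *
          (if e ∈ (univ : Finset (Sym2 V)).filter (fun e => ¬ e.IsDiag) \ S then 1 - (p : ℝ)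
            else 1) := by
      intro e
      by_cases he : e ∈ S
      · have := hS he
        simp only [Set.mem_compl_iff, Sym2.mem_diagSet] at this
        simp [he, edgeWeight, this]
      · by_cases hd : e.IsDiag <;> simp [he, edgeWeight, hd]
    simp only [h, Finset.prod_mul_distrib, Finset.prod_ite_mem, univ_inter, Finset.prod_const]
    rw [Set.ncard_coe_finset]
    congr 2
    rw [← Set.ncard_coe_finset]
    congr 1
    ext e
    simp
  · rw [MeasureTheory.measureReal_def, setBernoulli_singleton_of_not_subset p hS]
    obtain ⟨e, he, hd⟩ := Set.not_subset.1 hS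
    refine Finset.prod_eq_zero (mem_univ e) ?_
    simp only [Set.mem_compl_iff, Sym2.mem_diagSet, not_not] at hd
    simp [mem_coe.1 he, edgeWeight, hd]

open Classical in
theorem binomialRandom_real_eq_expect (p : unitInterval) (Q : SimpleGraph V → Prop) :
    (SimpleGraph.binomialRandom V p).real {G | Q G} =
      expect (edgeWeight V p)
        (fun S => if Q (SimpleGraph.fromEdgeSet (S : Set (Sym2 V))) then 1 else 0) := by
  have hQ : MeasurableSet {G : SimpleGraph V | Q G} := by
    rw [← Set.preimage_image_eq {G : SimpleGraph V | Q G} SimpleGraph.edgeSet_injective]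
    exact SimpleGraph.measurable_edgeSet (Set.toFinite _).measurableSet
  rw [SimpleGraph.binomialRandom_eq_map, MeasureTheory.map_measureReal_apply
    SimpleGraph.measurable_fromEdgeSet hQ]
  unfold expect
  simp only [weight_edgeWeight, mul_ite, mul_one, mul_zero]
  rw [← Finset.sum_filter]
  set A : Finset (Finset (Sym2 V)) := (univ : Finset (Finset (Sym2 V))).filter
    (fun S : Finset (Sym2 V) => Q (SimpleGraph.fromEdgeSet (S : Set (Sym2 V)))) with hA
  rw [show (SimpleGraph.fromEdgeSet ⁻¹' {G : SimpleGraph V | Q G}) =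
    ((A.map ⟨fun S : Finset (Sym2 V) => (S : Set (Sym2 V)), Finset.coe_injective⟩ : Finset (Set (Sym2 V))) :
      Set (Set (Sym2 V))) from ?_]
  · rw [← MeasureTheory.sum_measureReal_singleton, Finset.sum_map]
    rfl
  · ext s
    simp only [Set.mem_preimage, Set.mem_ofPred_eq, hA, coe_map, Function.Embedding.coeFn_mk,
      coe_filter, Set.mem_image, mem_univ, true_and]
    constructor
    · intro h
      exact ⟨s.toFinset, by simpa using h, by simp⟩
    · rintro ⟨S, h, rfl⟩
      exact h

end BernoulliSum

/-! ### The fan graph, its sparsity, and the first two moments of the number of copies. -/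

namespace FanGraph

open Finset BernoulliSum

set_option linter.unusedSectionVars false

/-- The vertices of the fan graph: a clique on `Fin 4`, and `k` further vertices joined to the
first two vertices of the clique. -/
abbrev Vertex (k : ℕ) : Type := Fin 4 ⊕ Fin k

/-- The edges of the fan graph, oriented. -/
def Arc {k : ℕ} : Vertex k → Vertex k → Prop
  | .inl i, .inl j => i < j
  | .inl i, .inr _ => i < 2
  | .inr _, _ => False

instance {k : ℕ} : DecidableRel (Arc (k := k))
  | .inl i, .inl j => inferInstanceAs (Decidable (i < j))
  | .inl i, .inr _ => inferInstanceAs (Decidable (i < 2))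
  | .inr _, _ => inferInstanceAs (Decidable False)

/-- The set of oriented edges of the fan graph. -/
def arcs (k : ℕ) : Finset (Vertex k × Vertex k) := univ.filter fun x => Arc x.1 x.2

/-- The oriented edges of the fan graph inside `S`. -/
def arcsIn {k : ℕ} (S : Finset (Vertex k)) : Finset (Vertex k × Vertex k) :=
  (arcs k).filter fun x => x.1 ∈ S ∧ x.2 ∈ S

theorem arc_inl_inl {k : ℕ} {i j : Fin 4} : Arc (.inl i : Vertex k) (.inl j) ↔ i < j := Iff.rfl

theorem arc_inl_inr {k : ℕ} {i : Fin 4} {j : Fin k} : Arc (.inl i) (.inr j) ↔ i < 2 := Iff.rfl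

theorem not_arc_inr {k : ℕ} {i : Fin k} {j : Vertex k} : ¬ Arc (.inr i) j := id

theorem mem_arcs {k : ℕ} {i j : Vertex k} : (i, j) ∈ arcs k ↔ Arc i j := by simp [arcs]

theorem mem_arcsIn {k : ℕ} {S : Finset (Vertex k)} {i j : Vertex k} :
    (i, j) ∈ arcsIn S ↔ Arc i j ∧ i ∈ S ∧ j ∈ S := by simp [arcsIn, mem_arcs]

theorem card_arcs (k : ℕ) : #(arcs k) = 2 * (k + 3) := by
  unfold arcs
  rw [Finset.card_filter, Fintype.sum_prod_type]
  have h1 : ∑ i : Fin 4, ∑ j : Fin 4, (if i < j then 1 else 0) = 6 := by decide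
  have h2 : ∑ i : Fin 4, (if i < 2 then k else 0) = 2 * k := by
    simp [Fin.sum_univ_four, two_mul]
  simp only [Fintype.sum_sum_type, arc_inl_inl, arc_inl_inr, not_arc_inr, Finset.sum_add_distrib,
    h1, Finset.sum_const, card_univ, Fintype.card_fin, if_false, smul_eq_mul, mul_ite, mul_one,
    mul_zero, h2]
  omega

/-- The fan graph is `(2, 2)`-sparse. -/
theorem card_arcsIn_add_two_le {k : ℕ} {S : Finset (Vertex k)} (hS : S.Nonempty) :
    #(arcsIn S) + 2 ≤ 2 * #S := by
  -- The clique part is a finite check. Each further vertex adds at most two edges, those to the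
  -- hubs, so the bound persists; without clique vertices there are no edges at all.
  have h4 : ∀ T : Finset (Fin 4), T.Nonempty →
      #((univ : Finset (Fin 4 × Fin 4)).filter fun x => x.1 < x.2 ∧ x.1 ∈ T ∧ x.2 ∈ T) + 2 ≤
        2 * #T := by decide
  have hc := Finset.card_toLeft_add_card_toRight (u := S)
  have hsub : arcsIn S ⊆
      (((univ : Finset (Fin 4 × Fin 4)).filter
        fun x => x.1 < x.2 ∧ x.1 ∈ S.toLeft ∧ x.2 ∈ S.toLeft).image
          fun x => ((.inl x.1 : Vertex k), (.inl x.2 : Vertex k))) ∪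
      ((({0, 1} : Finset (Fin 4)) ×ˢ S.toRight).image
          fun x => ((.inl x.1 : Vertex k), (.inr x.2 : Vertex k))) := by
    rintro ⟨i | i, j | j⟩ h <;> rw [mem_arcsIn] at h
    · simpa [arc_inl_inl] using h
    · have h2 : ∀ i : Fin 4, i < 2 → i = 0 ∨ i = 1 := by decide
      simp [h2 i (arc_inl_inr.1 h.1), h]
    · exact absurd h.1 not_arc_inr
    · exact absurd h.1 not_arc_inr
  rcases S.toLeft.eq_empty_or_nonempty with h | h
  · have : arcsIn S = ∅ := by
      rw [Finset.eq_empty_iff_forall_notMem]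
      rintro ⟨i | i, j⟩ hx
      · have hi : i ∈ S.toLeft := by simpa using (mem_arcsIn.1 hx).2.1
        simp [h] at hi
      · exact absurd (mem_arcsIn.1 hx).1 not_arc_inr
    rw [this]
    have := hS.card_pos
    simp only [card_empty]
    omega
  · have h1 := (card_le_card hsub).trans (card_union_le _ _)
    have h2 := h4 _ h
    have h3 : #((({0, 1} : Finset (Fin 4)) ×ˢ S.toRight).image
          fun x => ((.inl x.1 : Vertex k), (.inr x.2 : Vertex k))) ≤ 2 * #S.toRight :=
      card_image_le.trans (by simp)
    have h5 := Finset.card_image_le (s := (univ : Finset (Fin 4 × Fin 4)).filter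
        fun x => x.1 < x.2 ∧ x.1 ∈ S.toLeft ∧ x.2 ∈ S.toLeft)
          (f := fun x => ((.inl x.1 : Vertex k), (.inl x.2 : Vertex k)))
    omega

theorem Arc.ne {k : ℕ} {i j : Vertex k} (h : Arc i j) : i ≠ j := by
  rintro rfl
  rcases i with i | i
  · exact lt_irrefl i h
  · exact h

theorem Arc.asymm {k : ℕ} {i j : Vertex k} (h : Arc i j) : ¬ Arc j i := by
  rcases i with i | i <;> rcases j with j | j
  · exact fun h' => lt_asymm (α := Fin 4) h h'
  · exact id
  · exact h.elim
  · exact h.elim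

variable {V : Type*} [Fintype V] [DecidableEq V] {k : ℕ}

/-- The image of the edge set of the fan graph. -/
def edges (g : Vertex k ↪ V) : Finset (Sym2 V) := (arcs k).image fun x => s(g x.1, g x.2)

theorem mk_injOn_arcs (g : Vertex k ↪ V) :
    Set.InjOn (fun x : Vertex k × Vertex k => s(g x.1, g x.2)) (arcs k) := by
  rintro ⟨a, b⟩ h ⟨c, d⟩ h' he
  simp only [coe_filter, arcs, mem_univ, true_and, Set.mem_ofPred_eq] at h h'
  rcases Sym2.eq_iff.1 he with ⟨h1, h2⟩ | ⟨h1, h2⟩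
  · exact Prod.ext (g.injective h1) (g.injective h2)
  · cases g.injective h1
    cases g.injective h2
    exact absurd h' h.asymm

theorem card_edges (g : Vertex k ↪ V) : #(edges g) = 2 * (k + 3) := by
  rw [edges, card_image_of_injOn (mk_injOn_arcs g), card_arcs]

theorem not_isDiag_of_mem_edges {g : Vertex k ↪ V} {e : Sym2 V} (he : e ∈ edges g) :
    ¬ e.IsDiag := by
  obtain ⟨⟨i, j⟩, h, rfl⟩ := mem_image.1 he
  simp only [arcs, mem_filter, mem_univ, true_and] at h
  simpa using h.ne

theorem prod_edgeWeight_eq {p : ℝ} {F : Finset (Sym2 V)} (hF : ∀ e ∈ F, ¬ e.IsDiag) :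
    ∏ e ∈ F, edgeWeight V p e = p ^ #F := by
  rw [← Finset.prod_const]
  exact Finset.prod_congr rfl fun e he => by simp [edgeWeight, hF e he]

/-- An edge common to both copies has both ends in the image of `g`, so it comes from an arc inside
`S`; all other edges of `h` are new. -/
theorem card_edges_sdiff {g h : Vertex k ↪ V} {S : Finset (Vertex k)}
    (hS : ∀ i, i ∈ S ↔ h i ∈ univ.image g) :
    2 * (k + 3) ≤ #(edges h \ edges g) + #(arcsIn S) := by
  have h1 : edges h ∩ edges g ⊆ (arcsIn S).image fun x => s(h x.1, h x.2) := by
    intro e he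
    rw [mem_inter] at he
    obtain ⟨⟨i, j⟩, hij, rfl⟩ := mem_image.1 he.1
    obtain ⟨⟨a, b⟩, _, hab⟩ := mem_image.1 he.2
    refine mem_image.2 ⟨(i, j), mem_filter.2 ⟨hij, ?_⟩, rfl⟩
    rw [hS, hS]
    rcases Sym2.eq_iff.1 hab with ⟨h1, h2⟩ | ⟨h1, h2⟩
    · exact ⟨by simp [← h1], by simp [← h2]⟩
    · exact ⟨by simp [← h2], by simp [← h1]⟩
  have h2 := (card_le_card h1).trans card_image_le
  have h3 := Finset.card_sdiff_add_card_inter (edges h) (edges g)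
  rw [card_edges] at h3
  omega

/-- The second moment relative to one fixed copy `g`. Embeddings `h` are grouped by the set `S` of
vertices they send into the image of `g`: at most (k+4)^|S| n^(k+4-|S|) of them, each with at least
2(k+3) - |`arcsIn S`| new edges. Every one of the 2^(k+4) groups then contributes at most
(k+4)^(k+4). -/
theorem sum_pow_card_edges_sdiff_le {p : ℝ} (hp0 : 0 ≤ p) (hp1 : p ≤ 1)
    (h2 : (Fintype.card V : ℝ) * p ^ 2 ≤ 1)
    (hr : (Fintype.card V : ℝ) ^ (k + 4) * p ^ (2 * (k + 3)) ≤ 1) (g : Vertex k ↪ V) :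
    ∑ h : Vertex k ↪ V, p ^ #(edges h \ edges g) ≤ 2 ^ (k + 4) * (k + 4) ^ (k + 4) := by
  classical
  set n := Fintype.card V with hn
  let T : (Vertex k ↪ V) → Finset (Vertex k) := fun h => univ.filter fun i => h i ∈ univ.image g
  have hT : ∀ h i, i ∈ T h ↔ h i ∈ univ.image g := fun h i => by simp [T]
  have hcardT : ∀ S : Finset (Vertex k),
      #(univ.filter fun h : Vertex k ↪ V => T h = S) ≤ (k + 4) ^ #S * n ^ (k + 4 - #S) := by
    intro S
    have : #(univ.filter fun h : Vertex k ↪ V => T h = S) ≤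
        #(Fintype.piFinset fun i : Vertex k => if i ∈ S then univ.image g else univ) := by
      refine Finset.card_le_card_of_injOn (fun h => (h : Vertex k → V)) ?_
        (DFunLike.coe_injective.injOn)
      intro h hh
      simp only [coe_filter, mem_univ, true_and, Set.mem_ofPred_eq] at hh
      simp only [mem_coe, Fintype.mem_piFinset]
      intro i
      split_ifs with hi
      · rwa [← hT, hh]
      · simp
    refine this.trans (le_of_eq ?_)
    rw [Fintype.card_piFinset]
    have : ∀ i : Vertex k, #(if i ∈ S then univ.image g else univ) =
        if i ∈ S then (k + 4) else n := by
      intro i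
      split_ifs
      · rw [card_image_of_injective _ g.injective, card_univ]
        simp [add_comm]
      · rw [card_univ]
    simp only [this, Finset.prod_ite, Finset.prod_const]
    congr 2
    · simp
    · have h := Finset.card_compl S
      rw [Fintype.card_sum, Fintype.card_fin, Fintype.card_fin, add_comm 4] at h
      rw [← h]
      congr 1
      ext; simp
  have hbound : ∀ S : Finset (Vertex k), (n : ℝ) ^ (k + 4 - #S) * p ^ (2 * (k + 3) - #(arcsIn S)) ≤ 1 := by
    intro S
    rcases S.eq_empty_or_nonempty with rfl | hS
    · simpa [arcsIn] using hr
    · have h := card_arcsIn_add_two_le hS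
      have hle : #S ≤ k + 4 := (card_le_univ S).trans (by simp [add_comm])
      calc (n : ℝ) ^ (k + 4 - #S) * p ^ (2 * (k + 3) - #(arcsIn S))
          ≤ (n : ℝ) ^ (k + 4 - #S) * p ^ (2 * (k + 4 - #S)) := by
            refine mul_le_mul_of_nonneg_left ?_ (by positivity)
            exact pow_le_pow_of_le_one hp0 hp1 (by omega)
        _ = ((n : ℝ) * p ^ 2) ^ (k + 4 - #S) := by rw [mul_pow, pow_mul]
        _ ≤ 1 := pow_le_one₀ (by positivity) h2
  calc ∑ h : Vertex k ↪ V, p ^ #(edges h \ edges g)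
      ≤ ∑ h : Vertex k ↪ V, p ^ (2 * (k + 3) - #(arcsIn (T h))) := by
        refine Finset.sum_le_sum fun h _ => pow_le_pow_of_le_one hp0 hp1 ?_
        have := card_edges_sdiff (g := g) (hT h)
        omega
    _ = ∑ S : Finset (Vertex k), ∑ h ∈ univ.filter (fun h : Vertex k ↪ V => T h = S),
          p ^ (2 * (k + 3) - #(arcsIn S)) := by
        rw [← Finset.sum_fiberwise (s := univ) (g := T)]
        refine Finset.sum_congr rfl fun S _ => Finset.sum_congr rfl fun h hh => ?_
        rw [(mem_filter.1 hh).2]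
    _ ≤ ∑ S : Finset (Vertex k), ((k : ℝ) + 4) ^ (k + 4) := by
        refine Finset.sum_le_sum fun S _ => ?_
        rw [Finset.sum_const, nsmul_eq_mul]
        have hle : #S ≤ k + 4 := (card_le_univ S).trans (by simp [add_comm])
        calc _ ≤ (((k + 4) ^ #S * n ^ (k + 4 - #S) : ℕ) : ℝ) *
              p ^ (2 * (k + 3) - #(arcsIn S)) := by
              refine mul_le_mul_of_nonneg_right ?_ (by positivity)
              exact_mod_cast hcardT S
          _ = ((k : ℝ) + 4) ^ #S * ((n : ℝ) ^ (k + 4 - #S) *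
              p ^ (2 * (k + 3) - #(arcsIn S))) := by push_cast; ring
          _ ≤ ((k : ℝ) + 4) ^ #S * 1 := by
              exact mul_le_mul_of_nonneg_left (hbound S) (by positivity)
          _ ≤ _ := by
              rw [mul_one]
              exact pow_le_pow_right₀ (by linarith [(Nat.cast_nonneg k : (0 : ℝ) ≤ k)]) hle
    _ = _ := by
        rw [Finset.sum_const, card_univ, Fintype.card_finset, nsmul_eq_mul]
        simp [add_comm]

theorem expect_edges_subset (p : ℝ) (g : Vertex k ↪ V) :
    expect (edgeWeight V p) (fun S => if edges g ⊆ S then 1 else 0) = p ^ (2 * (k + 3)) := by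
  rw [expect_subset, prod_edgeWeight_eq fun e he => not_isDiag_of_mem_edges he, card_edges]

theorem expect_edges_union_subset (p : ℝ) (g h : Vertex k ↪ V) :
    expect (edgeWeight V p) (fun S => if edges g ∪ edges h ⊆ S then 1 else 0) =
      p ^ (2 * (k + 3)) * p ^ #(edges h \ edges g) := by
  rw [expect_subset, prod_edgeWeight_eq, ← pow_add, ← card_edges g]
  · congr 1
    rw [← Finset.card_union_of_disjoint Finset.disjoint_sdiff, Finset.union_sdiff_self_eq_union]
  · intro e he
    rcases mem_union.1 he with he | he <;> exact not_isDiag_of_mem_edges he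

theorem card_embedding_le : (Fintype.card (Vertex k ↪ V)) ≤ Fintype.card V ^ (k + 4) := by
  rw [Fintype.card_embedding_eq]
  refine (Nat.descFactorial_le_pow _ _).trans ?_
  simp [add_comm]

/-- The expected square of the number of copies of the fan graph is bounded. -/
theorem expect_card_copies_sq_le {p : ℝ} (hp0 : 0 ≤ p) (hp1 : p ≤ 1)
    (h2 : (Fintype.card V : ℝ) * p ^ 2 ≤ 1)
    (hr : (Fintype.card V : ℝ) ^ (k + 4) * p ^ (2 * (k + 3)) ≤ 1) :
    expect (edgeWeight V p) (fun S => (∑ g : Vertex k ↪ V, if edges g ⊆ S then 1 else 0) ^ 2) ≤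
      2 ^ (k + 4) * (k + 4) ^ (k + 4) := by
  have h : ∀ S : Finset (Sym2 V), (∑ g : Vertex k ↪ V, if edges g ⊆ S then (1 : ℝ) else 0) ^ 2 =
      ∑ g : Vertex k ↪ V, ∑ h : Vertex k ↪ V, if edges g ∪ edges h ⊆ S then 1 else 0 := by
    intro S
    rw [sq, Finset.sum_mul_sum]
    refine Finset.sum_congr rfl fun g _ => Finset.sum_congr rfl fun h _ => ?_
    simp only [union_subset_iff]
    by_cases a : edges g ⊆ S <;> by_cases b : edges h ⊆ S <;> simp [a, b]
  simp only [h, expect_sum, expect_edges_union_subset]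
  simp_rw [← Finset.mul_sum (s := univ) (f := fun h : Vertex k ↪ V => p ^ #(edges h \ edges _))]
  calc _ ≤ ∑ g : Vertex k ↪ V, p ^ (2 * (k + 3)) * ((2 : ℝ) ^ (k + 4) * (k + 4) ^ (k + 4)) :=
        Finset.sum_le_sum fun g _ => mul_le_mul_of_nonneg_left
          (sum_pow_card_edges_sdiff_le hp0 hp1 h2 hr g) (by positivity)
    _ = (Fintype.card (Vertex k ↪ V) * p ^ (2 * (k + 3))) *
          ((2 : ℝ) ^ (k + 4) * (k + 4) ^ (k + 4)) := by
        rw [Finset.sum_const, card_univ, nsmul_eq_mul]; ring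
    _ ≤ 1 * _ := by
        refine mul_le_mul_of_nonneg_right (le_trans ?_ hr) (by positivity)
        refine mul_le_mul_of_nonneg_right ?_ (by positivity)
        exact_mod_cast card_embedding_le
    _ = _ := one_mul _

/-- Exchanging the first two vertices of the fan graph. -/
def swapHubs (g : Vertex k ↪ V) : Vertex k ↪ V :=
  (Equiv.swap (Sum.inl 0) (Sum.inl 1)).toEmbedding.trans g

theorem swapHubs_ne (g : Vertex k ↪ V) : swapHubs g ≠ g := by
  intro h
  have := DFunLike.congr_fun h (.inl 0)
  simp [swapHubs] at this

theorem edges_swapHubs_subset (g : Vertex k ↪ V) : edges (swapHubs g) ⊆ edges g := by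
  intro e he
  obtain ⟨⟨i, j⟩, h, rfl⟩ := mem_image.1 he
  simp only [arcs, mem_filter, mem_univ, true_and] at h
  have key : Arc (Equiv.swap (.inl 0 : Vertex k) (.inl 1) i) (Equiv.swap (.inl 0) (.inl 1) j) ∨
      Arc (Equiv.swap (.inl 0 : Vertex k) (.inl 1) j) (Equiv.swap (.inl 0) (.inl 1) i) := by
    have hs : ∀ i : Fin 4, Equiv.swap (.inl 0 : Vertex k) (.inl 1) (.inl i) =
        .inl (Equiv.swap 0 1 i) := fun i => by
      rw [Sum.inl_injective.swap_apply]
    have hs' : ∀ i : Fin k, Equiv.swap (.inl 0 : Vertex k) (.inl 1) (.inr i) = .inr i :=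
      fun i => Equiv.swap_apply_of_ne_of_ne (by simp) (by simp)
    rcases i with i | i <;> rcases j with j | j
    · have hd : ∀ i j : Fin 4, i < j → Equiv.swap 0 1 i < Equiv.swap 0 1 j ∨
          Equiv.swap 0 1 j < Equiv.swap 0 1 i := by decide
      rw [hs, hs]
      exact hd i j h
    · have hd : ∀ i : Fin 4, i < 2 → Equiv.swap 0 1 i < 2 := by decide
      rw [hs, hs']
      exact Or.inl (hd i h)
    · exact h.elim
    · exact h.elim
  rcases key with h' | h'
  · exact mem_image.2 ⟨_, mem_filter.2 ⟨mem_univ (_, _), h'⟩, rfl⟩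
  · exact mem_image.2 ⟨_, mem_filter.2 ⟨mem_univ (_, _), h'⟩, Sym2.eq_swap⟩

-- A copy is counted by at least two embeddings, `g` and `swapHubs g`, so the indicator is at most
-- half the count. This factor 1/2 is what keeps the probability away from 1.
open Classical in
theorem expect_exists_copy_le {p : ℝ} (hp0 : 0 ≤ p) (hp1 : p ≤ 1)
    (hr : (Fintype.card V : ℝ) ^ (k + 4) * p ^ (2 * (k + 3)) ≤ 1) :
    expect (edgeWeight V p) (fun S => if ∃ g : Vertex k ↪ V, edges g ⊆ S then 1 else 0) ≤
      1 / 2 := by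
  have h : ∀ S : Finset (Sym2 V), (if ∃ g : Vertex k ↪ V, edges g ⊆ S then (1 : ℝ) else 0) ≤
      1 / 2 * ∑ g : Vertex k ↪ V, if edges g ⊆ S then (1 : ℝ) else 0 := by
    intro S
    split_ifs with hS
    · obtain ⟨g, hg⟩ := hS
      have h1 : ∑ g ∈ {g, swapHubs g}, (if edges g ⊆ S then (1 : ℝ) else 0) ≤
          ∑ g : Vertex k ↪ V, if edges g ⊆ S then (1 : ℝ) else 0 :=
        Finset.sum_le_sum_of_subset_of_nonneg (Finset.subset_univ _)
          fun _ _ _ => by split_ifs <;> norm_num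
      rw [Finset.sum_pair (swapHubs_ne g).symm, if_pos hg,
        if_pos ((edges_swapHubs_subset g).trans hg)] at h1
      linarith
    · exact mul_nonneg (by norm_num) (Finset.sum_nonneg fun _ _ => by split_ifs <;> norm_num)
  refine (expect_mono (edgeWeight_nonneg hp0) (fun e => (edgeWeight_le hp0 e).trans hp1) h).trans ?_
  rw [expect_const_mul, expect_sum]
  simp only [expect_edges_subset, Finset.sum_const, card_univ, nsmul_eq_mul]
  have : (Fintype.card (Vertex k ↪ V) : ℝ) * p ^ (2 * (k + 3)) ≤ 1 := by
    refine le_trans (mul_le_mul_of_nonneg_right ?_ (by positivity)) hr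
    exact_mod_cast card_embedding_le
  linarith

end FanGraph

/-! ### Fan sets and copies of the fan graph; copies without detours. -/

namespace FanGraph

open Finset BernoulliSum

set_option linter.unusedSectionVars false

variable {V : Type*} [Fintype V] [DecidableEq V] {k : ℕ}

/-- The common neighbour `y` and the dominating element `x` serve as hubs, an edge of the triangle
completes the clique, and any `k` other elements of `X` serve as the further vertices. -/
theorem exists_embedding_of_isFanSet {G : SimpleGraph V} {X : Set V} (h : G.IsFanSet X)
    (hX : k + 3 ≤ X.ncard) : ∃ g : Vertex k ↪ V, ∀ i j, Arc i j → G.Adj (g i) (g j) := by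
  classical
  obtain ⟨⟨y, hy⟩, ⟨x, hx, hxX⟩, a, b, c, ha, hb, hc, hab, hac, hbc⟩ := h
  have hxa : ∀ u ∈ X, u ≠ x → G.Adj x u := fun u hu hux => (hxX u hu).resolve_left hux
  -- At most one vertex of the triangle is `x`, so some edge of it avoids `x`.
  obtain ⟨a, b, ha, hb, hax, hbx, hab⟩ :
      ∃ a b, a ∈ X ∧ b ∈ X ∧ a ≠ x ∧ b ≠ x ∧ G.Adj a b := by
    by_cases h1 : a = x
    · subst h1
      exact ⟨b, c, hb, hc, hab.ne', hac.ne', hbc⟩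
    · by_cases h2 : b = x
      · subst h2
        exact ⟨a, c, ha, hc, hab.ne, hbc.ne', hac⟩
      · exact ⟨a, b, ha, hb, h1, h2, hab⟩
  have hyX : y ∉ X := fun h => (hy y h).ne rfl
  have hcard : k ≤ #(X.toFinset \ {x, a, b}) := by
    have h1 := Finset.le_card_sdiff {x, a, b} X.toFinset
    have h2 : #({x, a, b} : Finset V) ≤ 3 := Finset.card_le_three
    rw [← Set.ncard_eq_toFinset_card'] at h1
    omega
  obtain ⟨c⟩ : Nonempty (Fin k ↪ (X.toFinset \ {x, a, b} : Finset V)) := by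
    refine Function.Embedding.nonempty_of_card_le ?_
    rw [Fintype.card_fin, Fintype.card_coe]
    exact hcard
  have hcX : ∀ i, (c i : V) ∈ X ∧ (c i : V) ≠ x ∧ (c i : V) ≠ a ∧ (c i : V) ≠ b := fun i => by
    have h := Finset.mem_sdiff.1 (c i).2
    simp only [Set.mem_toFinset, mem_insert, mem_singleton, not_or] at h
    exact h
  have hne : ∀ u ∈ X, y ≠ u := fun u hu h => hyX (h ▸ hu)
  have hinj : Function.Injective ![y, x, a, b] := by
    intro i j
    fin_cases i <;> fin_cases j <;>
      simp [hne x hx, hne a ha, hne b hb, (hne x hx).symm, (hne a ha).symm, (hne b hb).symm, hax,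
        hbx, hax.symm, hbx.symm, hab.ne, hab.ne']
  refine ⟨⟨Sum.elim ![y, x, a, b] fun i => c i, ?_⟩, ?_⟩
  · refine hinj.sumElim (Subtype.val_injective.comp c.injective) ?_
    intro i j
    obtain ⟨h1, h2, h3, h4⟩ := hcX j
    fin_cases i <;> simp [hne _ h1, h2.symm, h3.symm, h4.symm]
  · rintro (i | i) (j | j) h
    · fin_cases i <;> fin_cases j <;> simp [arc_inl_inl] at h <;>
        simp [hy x hx, hy a ha, hy b hb, hxa a ha hax, hxa b hb hbx, hab]
    · obtain ⟨h1, h2, h3, h4⟩ := hcX j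
      have h0 : i = 0 ∨ i = 1 := by
        have : ∀ i : Fin 4, i < 2 → i = 0 ∨ i = 1 := by decide
        exact this i (arc_inl_inr.1 h)
      rcases h0 with rfl | rfl
      · simpa using hy _ h1
      · simpa using hxa _ h1 h2
    · exact absurd h not_arc_inr
    · exact absurd h not_arc_inr

/-- The vertices of the fan graph other than the first hub. -/
abbrev Rest (k : ℕ) : Type := {i : Vertex k // i ≠ .inl 0}

theorem card_rest (k : ℕ) : Fintype.card (Rest k) = k + 3 := by
  rw [Fintype.card_subtype_compl]
  simp
  omega

/-- The paths of length `2` from `v`, via the vertices `f i`, to the vertices of a copy of the fan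
graph other than its first hub. -/
def detour (g : Vertex k ↪ V) (v : V) (f : Rest k → V) : Finset (Sym2 V) :=
  (univ.image fun i => s(f i, g i)) ∪ (univ.image fun i => s(f i, v))

/-- The pairs `v`, `f` such that `v` is not one of the endpoints and no `f i` is in the copy `g`. -/
def detourIndex (g : Vertex k ↪ V) : Finset (V × (Rest k → V)) :=
  univ.filter fun x => (∀ i : Rest k, x.1 ≠ g i) ∧ ∀ i j, x.2 i ≠ g j

/-- The set is the copy without its first hub. A centre together with the chosen intermediate
vertices would be a detour indexed by `detourIndex g`. -/
theorem isFanSet_and_not_isCentered {g : Vertex k ↪ V} {S : Finset (Sym2 V)}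
    (hg : edges g ⊆ S) (hS : ∀ x ∈ detourIndex g, ¬ detour g x.1 x.2 ⊆ S) :
    ∃ X, (SimpleGraph.fromEdgeSet (S : Set (Sym2 V))).IsFanSet X ∧
      ¬ (SimpleGraph.fromEdgeSet (S : Set (Sym2 V))).IsCentered X := by
  set G := SimpleGraph.fromEdgeSet (S : Set (Sym2 V)) with hG
  have hadj : ∀ i j, Arc i j → G.Adj (g i) (g j) := fun i j hij => by
    rw [hG, SimpleGraph.fromEdgeSet_adj]
    exact ⟨mem_coe.2 (hg (mem_image.2 ⟨(i, j), mem_arcs.2 hij, rfl⟩)), g.injective.ne hij.ne⟩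
  have h4 : ∀ i j : Fin 4, i < j → G.Adj (g (.inl i)) (g (.inl j)) := fun i j h => hadj _ _ h
  have h2 : ∀ (i : Fin 4) (j : Fin k), i < 2 → G.Adj (g (.inl i)) (g (.inr j)) :=
    fun i j h => hadj _ _ h
  have hhub : ∀ i : Rest k, G.Adj (g (.inl 0)) (g i) := by
    rintro ⟨i | i, hi⟩
    · exact h4 0 i (Fin.pos_iff_ne_zero.2 fun h => hi (h ▸ rfl))
    · exact h2 0 i (by decide)
  let X : Set V := Set.range fun i : Rest k => g i
  refine ⟨X, ⟨⟨g (.inl 0), ?_⟩, ⟨g (.inl 1), ⟨⟨.inl 1, by simp⟩, rfl⟩, ?_⟩,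
    g (.inl 1), g (.inl 2), g (.inl 3), ⟨⟨.inl 1, by simp⟩, rfl⟩, ⟨⟨.inl 2, by simp⟩, rfl⟩,
    ⟨⟨.inl 3, by simp⟩, rfl⟩, h4 _ _ (by decide), h4 _ _ (by decide), h4 _ _ (by decide)⟩, ?_⟩
  · rintro _ ⟨i, rfl⟩
    exact hhub i
  · rintro _ ⟨⟨i | i, hi⟩, rfl⟩
    · have : ∀ i : Fin 4, i ≠ 0 → i = 1 ∨ 1 < i := by decide
      rcases this i (fun h => hi (h ▸ rfl)) with rfl | h
      · exact Or.inl rfl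
      · exact Or.inr (h4 _ _ h)
    · exact Or.inr (h2 1 i (by decide))
  · rintro ⟨v, hv, hdom⟩
    have hv' : ∀ i : Rest k, ∃ w, w ∉ X ∧ G.Adj w (g i) ∧ G.Adj w v := fun i => hv _ ⟨i, rfl⟩
    choose f hfX hfg hfv using hv'
    -- The hub is adjacent to all of `X`, so the last clause of `IsCentered` forbids it as a
    -- neighbour of `v`. Hence `v` lies outside `X` and no path to `v` runs through the hub.
    have hy : ¬ G.Adj (g (.inl 0)) v := fun h =>
      hdom ⟨_, h, by rintro _ ⟨i, rfl⟩; exact hhub i⟩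
    refine hS (v, f) (mem_filter.2 ⟨mem_univ _, ?_, ?_⟩) ?_
    · rintro i rfl
      exact hy (hhub i)
    · intro i j hij
      by_cases hj : j = .inl 0
      · subst hj
        exact hy (hij ▸ hfv i)
      · exact hfX i ⟨⟨j, hj⟩, hij.symm⟩
    · intro e he
      rcases mem_union.1 he with he | he
      · obtain ⟨i, _, rfl⟩ := mem_image.1 he
        have := hfg i
        rw [hG, SimpleGraph.fromEdgeSet_adj] at this
        exact mem_coe.1 this.1
      · obtain ⟨i, _, rfl⟩ := mem_image.1 he
        have := hfv i
        rw [hG, SimpleGraph.fromEdgeSet_adj] at this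
        exact mem_coe.1 this.1

/-- The edges at the copy are distinct even when the `f i` coincide; the edges at `v` are counted by
the distinct values of `f` only. -/
theorem le_card_detour {g : Vertex k ↪ V} {x : V × (Rest k → V)} (hx : x ∈ detourIndex g) :
    k + 3 + #(univ.image x.2) ≤ #(detour g x.1 x.2) := by
  obtain ⟨v, f⟩ := x
  obtain ⟨hv, hf⟩ := (mem_filter.1 hx).2
  unfold detour
  rw [card_union_of_disjoint]
  · refine add_le_add ?_ ?_
    · rw [card_image_of_injective, card_univ, card_rest]
      intro i j hij
      rcases Sym2.eq_iff.1 hij with ⟨_, h⟩ | ⟨h, _⟩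
      · exact Subtype.ext (g.injective h)
      · exact absurd h (hf i j)
    · have : (univ.image fun i => s(f i, v)) = (univ.image f).image fun w => s(w, v) := by
        rw [image_image]; rfl
      rw [this, card_image_of_injective (univ.image f)]
      intro a b hab
      exact Sym2.congr_left.1 hab
  · rw [Finset.disjoint_left]
    intro e he he'
    obtain ⟨i, _, rfl⟩ := mem_image.1 he
    obtain ⟨j, _, hj⟩ := mem_image.1 he'
    rcases Sym2.eq_iff.1 hj with ⟨_, h⟩ | ⟨h, _⟩
    · exact hv i h
    · exact hf j i h

/-- Every detour edge contains some `f i`, which lies outside the copy. This gives the independence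
used for the expected number of copies without detours. -/
theorem disjoint_edges_detour {g : Vertex k ↪ V} {x : V × (Rest k → V)}
    (hx : x ∈ detourIndex g) : Disjoint (edges g) (detour g x.1 x.2) := by
  obtain ⟨hv, hf⟩ := (mem_filter.1 hx).2
  rw [Finset.disjoint_left]
  intro e he he'
  obtain ⟨⟨a, b⟩, _, rfl⟩ := mem_image.1 he
  have key : ∀ i c, s(x.2 i, c) ≠ s(g a, g b) := fun i c h => by
    rcases Sym2.eq_iff.1 h with ⟨h, _⟩ | ⟨h, _⟩ <;> exact hf _ _ h
  rcases mem_union.1 he' with h | h <;> obtain ⟨i, _, hi⟩ := mem_image.1 h <;> exact key _ _ hi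

/-- Values are chosen one at a time: a new value has at most n choices and costs a factor p, an old
one has at most `K` choices and costs nothing. `K` is kept fixed so that the induction on `m`
closes. -/
theorem sum_pow_card_image_fin_le {p : ℝ} (hp : 0 ≤ p) (m K : ℕ) (hm : m ≤ K) :
    ∑ f : Fin m → V, p ^ #(univ.image f) ≤ (Fintype.card V * p + K) ^ m := by
  induction m with
  | zero => simp
  | succ m ih =>
    rw [← (Fin.consEquiv fun _ : Fin (m + 1) => V).sum_comp, Fintype.sum_prod_type,
      Finset.sum_comm]
    have him : ∀ (f : Fin m → V) (a : V),
        univ.image (Fin.consEquiv (fun _ : Fin (m + 1) => V) (a, f)) =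
          insert a (univ.image f) := by
      intro f a
      ext b
      simp [Fin.consEquiv, Fin.exists_fin_succ, eq_comm]
    simp only [him]
    have hle : ∀ f : Fin m → V, ∑ a : V, p ^ #(insert a (univ.image f)) ≤
        p ^ #(univ.image f) * (Fintype.card V * p + K) := by
      intro f
      calc ∑ a : V, p ^ #(insert a (univ.image f))
          ≤ ∑ a : V, (p ^ #(univ.image f) * p +
              if a ∈ univ.image f then p ^ #(univ.image f) else 0) := by
            refine Finset.sum_le_sum fun a _ => ?_
            split_ifs with ha
            · rw [insert_eq_self.2 ha]
              have : 0 ≤ p ^ #(univ.image f) * p := by positivity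
              linarith
            · rw [card_insert_of_notMem ha, pow_succ, add_zero]
        _ = p ^ #(univ.image f) * (Fintype.card V * p + #(univ.image f)) := by
            rw [Finset.sum_add_distrib, Finset.sum_const, Finset.sum_ite_mem, univ_inter,
              Finset.sum_const, card_univ, nsmul_eq_mul, nsmul_eq_mul]
            ring
        _ ≤ _ := by
            have : #(univ.image f) ≤ K := card_image_le.trans (by simp; omega)
            have : (#(univ.image f) : ℝ) ≤ K := by exact_mod_cast this
            gcongr
    refine (Finset.sum_le_sum fun f _ => hle f).trans ?_
    rw [← Finset.sum_mul, pow_succ]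
    exact mul_le_mul_of_nonneg_right (ih (by omega)) (by positivity)

theorem sum_pow_card_image_le {ι : Type*} [Fintype ι] [DecidableEq ι] {p : ℝ} (hp : 0 ≤ p) :
    ∑ f : ι → V, p ^ #(univ.image f) ≤
      (Fintype.card V * p + Fintype.card ι) ^ Fintype.card ι := by
  refine le_trans (le_of_eq ?_) (sum_pow_card_image_fin_le (V := V) hp _ _ le_rfl)
  rw [← ((Fintype.equivFin ι).arrowCongr (Equiv.refl V)).sum_comp]
  refine Finset.sum_congr rfl fun f _ => ?_
  congr 2
  ext b
  simp [(Fintype.equivFin ι).symm.surjective.exists]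

theorem exp_neg_le_one_sub {x : ℝ} (h0 : 0 ≤ x) (h1 : x ≤ 1 / 2) : Real.exp (-(2 * x)) ≤ 1 - x := by
  rw [Real.exp_neg]
  have h2 := Real.add_one_le_exp (2 * x)
  rw [inv_le_comm₀ (Real.exp_pos _) (by linarith), inv_le_iff_one_le_mul₀ (by linarith)]
  nlinarith

theorem prod_edgeWeight_le {p : ℝ} (hp0 : 0 ≤ p) (F : Finset (Sym2 V)) :
    ∏ e ∈ F, edgeWeight V p e ≤ p ^ #F := by
  rw [← Finset.prod_const]
  exact Finset.prod_le_prod (fun e _ => edgeWeight_nonneg hp0 e) fun e _ => edgeWeight_le hp0 e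

theorem prod_edgeWeight_detour_le {p : ℝ} (hp0 : 0 ≤ p) (hp1 : p ≤ 1) {g : Vertex k ↪ V}
    {x : V × (Rest k → V)} (hx : x ∈ detourIndex g) :
    ∏ e ∈ detour g x.1 x.2, edgeWeight V p e ≤ p ^ (k + 3 + #(univ.image x.2)) :=
  (prod_edgeWeight_le hp0 _).trans (pow_le_pow_of_le_one hp0 hp1 (le_card_detour hx))

theorem sum_pow_card_detour_le {n p : ℝ} (hp0 : 0 ≤ p) (hn : (Fintype.card V : ℝ) = n)
    (hnp : 1 ≤ n * p) (hr : n ^ (k + 4) * p ^ (2 * (k + 3)) ≤ 1) :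
    ∑ _v : V, ∑ f : Rest k → V, p ^ (k + 3 + #(univ.image f)) ≤ (k + 4) ^ (k + 3) := by
  have hn0 : 0 ≤ n := hn ▸ Nat.cast_nonneg _
  have hk : (0 : ℝ) ≤ k := Nat.cast_nonneg k
  have h := sum_pow_card_image_le (V := V) (ι := Rest k) hp0
  rw [card_rest, hn] at h
  push_cast at h
  simp only [pow_add p (k + 3), ← Finset.mul_sum, Finset.sum_const, card_univ, nsmul_eq_mul, hn]
  rw [mul_left_comm]
  -- Since np ≥ 1, the coincidences among the `f i` cost only a constant factor.
  have h3 : n * p + (k + 3) ≤ n * p * (k + 4) := by nlinarith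
  have h4 : (n * p + (k + 3)) ^ (k + 3) ≤ (n * p * (k + 4)) ^ (k + 3) :=
    pow_le_pow_left₀ (by positivity) h3 _
  calc _ ≤ n * (p ^ (k + 3) * (n * p * (k + 4)) ^ (k + 3)) :=
        mul_le_mul_of_nonneg_left (mul_le_mul_of_nonneg_left (h.trans h4) (by positivity)) hn0
    _ = (n ^ (k + 4) * p ^ (2 * (k + 3))) * (k + 4) ^ (k + 3) := by
        rw [mul_pow, mul_pow]; ring
    _ ≤ 1 * (k + 4) ^ (k + 3) := mul_le_mul_of_nonneg_right hr (by positivity)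
    _ = _ := one_mul _

theorem sum_prod_detour_le {p : ℝ} (hp0 : 0 ≤ p) (hp1 : p ≤ 1)
    (hnp : 1 ≤ (Fintype.card V : ℝ) * p)
    (hr : (Fintype.card V : ℝ) ^ (k + 4) * p ^ (2 * (k + 3)) ≤ 1) (g : Vertex k ↪ V) :
    ∑ x ∈ detourIndex g, ∏ e ∈ detour g x.1 x.2, edgeWeight V p e ≤ (k + 4) ^ (k + 3) := by
  refine (Finset.sum_le_sum fun x hx => prod_edgeWeight_detour_le hp0 hp1 hx).trans ?_
  refine (Finset.sum_le_sum_of_subset_of_nonneg (Finset.subset_univ _)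
    fun x _ _ => pow_nonneg hp0 _).trans ?_
  rw [Fintype.sum_prod_type]
  exact sum_pow_card_detour_le hp0 rfl hnp hr

/-- By Harris, the probability of no detour is at least the product of the individual probabilities.
The expected number of detours is bounded, and each has probability at most p ≤ 1/2, so 1 - x ≥
exp(-2x) applies to every factor. -/
theorem expect_not_detour_ge {p : ℝ} (hp0 : 0 ≤ p) (hp1 : p ≤ 1 / 2)
    (hnp : 1 ≤ (Fintype.card V : ℝ) * p)
    (hr : (Fintype.card V : ℝ) ^ (k + 4) * p ^ (2 * (k + 3)) ≤ 1) (g : Vertex k ↪ V) :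
    Real.exp (-(2 * (k + 4) ^ (k + 3))) ≤ expect (edgeWeight V p)
      (fun S => if ∀ x ∈ detourIndex g, ¬ detour g x.1 x.2 ⊆ S then 1 else 0) := by
  refine le_trans ?_ (prod_le_expect_forall_not_subset (edgeWeight_nonneg hp0)
    (fun e => (edgeWeight_le hp0 e).trans (by linarith)) (detourIndex g)
    fun x => detour g x.1 x.2)
  have hsum := sum_prod_detour_le hp0 (by linarith) hnp hr g
  calc Real.exp (-(2 * (k + 4) ^ (k + 3)))
      ≤ Real.exp (∑ x ∈ detourIndex g, -(2 * ∏ e ∈ detour g x.1 x.2, edgeWeight V p e)) := by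
        rw [Real.exp_le_exp, Finset.sum_neg_distrib, ← Finset.mul_sum]
        linarith
    _ = ∏ x ∈ detourIndex g, Real.exp (-(2 * ∏ e ∈ detour g x.1 x.2, edgeWeight V p e)) :=
        Real.exp_sum _ _
    _ ≤ _ := by
        refine Finset.prod_le_prod (fun x _ => (Real.exp_pos _).le) fun x hx =>
          exp_neg_le_one_sub (Finset.prod_nonneg fun e _ => edgeWeight_nonneg hp0 e) ?_
        refine (prod_edgeWeight_detour_le hp0 (by linarith) hx).trans (le_trans ?_ hp1)
        calc p ^ (k + 3 + #(univ.image x.2)) ≤ p ^ 1 :=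
              pow_le_pow_of_le_one hp0 (by linarith) (by omega)
          _ = p := pow_one p

/-- The probability that some copy of the fan graph has no detour is bounded below. -/
theorem expect_exists_copy_not_detour_ge {p : ℝ} (hp0 : 0 ≤ p) (hp1 : p ≤ 1 / 2)
    (hnp : 1 ≤ (Fintype.card V : ℝ) * p) (h2 : (Fintype.card V : ℝ) * p ^ 2 ≤ 1)
    (hr : (Fintype.card V : ℝ) ^ (k + 4) * p ^ (2 * (k + 3)) ≤ 1)
    (hg : 1 / 2 ≤ (Fintype.card (Vertex k ↪ V) : ℝ) * p ^ (2 * (k + 3))) :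
    (Real.exp (-(2 * (k + 4) ^ (k + 3))) / 2) ^ 2 / (2 ^ (k + 4) * (k + 4) ^ (k + 4)) ≤
      expect (edgeWeight V p) (fun S => if ∃ g : Vertex k ↪ V, edges g ⊆ S ∧
        ∀ x ∈ detourIndex g, ¬ detour g x.1 x.2 ⊆ S then 1 else 0) := by
  set c := Real.exp (-(2 * ((k : ℝ) + 4) ^ (k + 3))) with hc
  set q := edgeWeight V p with hq
  have hq0 : ∀ e, 0 ≤ q e := edgeWeight_nonneg hp0
  have hq1 : ∀ e, q e ≤ 1 := fun e => (edgeWeight_le hp0 e).trans (by linarith)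
  let Z : Finset (Sym2 V) → ℝ := fun S => ∑ g : Vertex k ↪ V, (if edges g ⊆ S then 1 else 0) *
    (if ∀ x ∈ detourIndex g, ¬ detour g x.1 x.2 ⊆ S then 1 else 0)
  let I : Finset (Sym2 V) → ℝ := fun S => if ∃ g : Vertex k ↪ V, edges g ⊆ S ∧
        ∀ x ∈ detourIndex g, ¬ detour g x.1 x.2 ⊆ S then 1 else 0
  have hZ : c / 2 ≤ expect q Z := by
    have h1 : expect q Z = ∑ g : Vertex k ↪ V, p ^ (2 * (k + 3)) * expect q
        (fun S => if ∀ x ∈ detourIndex g, ¬ detour g x.1 x.2 ⊆ S then 1 else 0) := by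
      simp only [Z]
      rw [expect_sum]
      refine Finset.sum_congr rfl fun g _ => ?_
      rw [expect_mul (A := edges g) (B := (detourIndex g).biUnion fun x => detour g x.1 x.2),
        expect_edges_subset]
      · refine dependsOn_of_iff fun S T hST h e he => ?_
        exact (mem_iff_of_inter_eq hST he).1 (h he)
      · refine dependsOn_of_iff fun S T hST h x hx hT => h x hx fun e he => ?_
        exact (mem_iff_of_inter_eq hST (mem_biUnion.2 ⟨x, hx, he⟩)).2 (hT he)
      · rw [Finset.disjoint_biUnion_right]
        exact fun x hx => disjoint_edges_detour hx
    rw [h1, ← Finset.mul_sum]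
    calc c / 2 ≤ ((Fintype.card (Vertex k ↪ V) : ℝ) * p ^ (2 * (k + 3))) * c := by
          nlinarith [Real.exp_pos (-(2 * ((k : ℝ) + 4) ^ (k + 3)))]
      _ = p ^ (2 * (k + 3)) * ∑ g : Vertex k ↪ V, c := by
          rw [Finset.sum_const, card_univ, nsmul_eq_mul]; ring
      _ ≤ _ := by
          refine mul_le_mul_of_nonneg_left (Finset.sum_le_sum fun g _ => ?_) (by positivity)
          exact expect_not_detour_ge hp0 hp1 hnp hr g
  -- `I` is the indicator of Z > 0, so Cauchy–Schwarz applied to Z = Z · I gives (E Z)² ≤ E Z² · P(Z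
  -- > 0).
  have hZI : ∀ S, Z S = Z S * I S := by
    intro S
    by_cases h : I S = 1
    · rw [h, mul_one]
    · have h' : ¬ ∃ g : Vertex k ↪ V, edges g ⊆ S ∧
        ∀ x ∈ detourIndex g, ¬ detour g x.1 x.2 ⊆ S := fun h' => h (if_pos h')
      have : Z S = 0 := Finset.sum_eq_zero fun g _ => by
        by_cases a : edges g ⊆ S
        · rw [if_neg (fun b => h' ⟨g, a, b⟩), mul_zero]
        · rw [if_neg a, zero_mul]
      rw [this, zero_mul]
  have hI : ∀ S, I S ^ 2 = I S := fun S => by simp only [I]; split_ifs <;> norm_num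
  -- Z is at most the number of all embedded copies, whose second moment is already bounded.
  have hZ2 : expect q (fun S => Z S ^ 2) ≤ 2 ^ (k + 4) * (k + 4) ^ (k + 4) := by
    refine le_trans (expect_mono hq0 hq1 fun S => ?_)
      (expect_card_copies_sq_le hp0 (by linarith) h2 hr)
    have hZ0 : 0 ≤ Z S := Finset.sum_nonneg fun g _ => by split_ifs <;> norm_num
    refine pow_le_pow_left₀ hZ0 (Finset.sum_le_sum fun g _ => ?_) 2
    split_ifs <;> norm_num
  have hcs := expect_mul_sq_le hq0 hq1 Z I
  simp only [← hZI, hI] at hcs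
  rw [div_le_iff₀ (by positivity)]
  have hI0 : 0 ≤ expect q I :=
    expect_nonneg hq0 hq1 fun S => by simp only [I]; split_ifs <;> norm_num
  calc (c / 2) ^ 2 ≤ expect q Z ^ 2 := pow_le_pow_left₀ (by positivity) hZ 2
    _ ≤ expect q (fun S => Z S ^ 2) * expect q I := hcs
    _ ≤ 2 ^ (k + 4) * (k + 4) ^ (k + 4) * expect q I := mul_le_mul_of_nonneg_right hZ2 hI0
    _ = _ := mul_comm _ _

end FanGraph

/-! ### Exponential tail bounds. -/

namespace BernoulliSum

open Finset

set_option linter.unusedSectionVars false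

section Tail

variable {E : Type*} [Fintype E] [DecidableEq E]

theorem expect_indicator_not (q : E → ℝ) (P : Finset E → Prop) [DecidablePred P] :
    expect q (fun S => if ¬ P S then 1 else 0) = 1 - expect q (fun S => if P S then 1 else 0) := by
  have h : (fun S => if ¬ P S then (1 : ℝ) else 0) = fun S => 1 - if P S then 1 else 0 := by
    funext S
    by_cases hS : P S <;> simp [hS]
  rw [h, expect_sub, expect_const]

variable {ι : Type*} [DecidableEq ι]

/-- A lower tail bound for the number of independent events of probability at least `t` that
occur. -/
theorem expect_card_lt_le {q : E → ℝ} (h0 : ∀ e, 0 ≤ q e) (h1 : ∀ e, q e ≤ 1) (s : Finset ι)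
    (P : ι → Finset E → Prop) [∀ i, DecidablePred (P i)] (A : ι → Finset E)
    (hP : ∀ i ∈ s, ∀ S T, S ∩ A i = T ∩ A i → P i S → P i T)
    (hA : (s : Set ι).PairwiseDisjoint A) {t : ℝ} (ht0 : 0 ≤ t)
    (ht : ∀ i ∈ s, t ≤ expect q (fun S => if P i S then 1 else 0)) :
    expect q (fun S => if (#(s.filter fun i => P i S) : ℝ) < t * #s / 8 then 1 else 0) ≤
      Real.exp (-(t * #s / 4)) := by
  -- Markov's inequality is applied to (1/2)^N, where N is the number of events that occur; the
  -- product of the `f i` equals this power, and each factor has mean at most 1 - t/2.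
  set f : ι → Finset E → ℝ := fun i S => if P i S then 1 / 2 else 1 with hf
  have hfe : ∀ i ∈ s, expect q (f i) ≤ Real.exp (-(t / 2)) := by
    intro i hi
    have : f i = fun S => 1 - 1 / 2 * (if P i S then 1 else 0) := by
      funext S
      simp only [hf]
      split_ifs <;> norm_num
    rw [this, expect_sub, expect_const, expect_const_mul]
    have h2 := Real.add_one_le_exp (-(t / 2))
    linarith [ht i hi]
  have hf0 : ∀ i S, 0 ≤ f i S := fun i S => by simp only [hf]; split_ifs <;> norm_num
  have hprod : expect q (fun S => ∏ i ∈ s, f i S) ≤ Real.exp (-(t * #s / 2)) := by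
    rw [expect_prod (A := A) s (fun i hi => dependsOn_of_iff (hP i hi)) hA]
    calc _ ≤ ∏ i ∈ s, Real.exp (-(t / 2)) :=
          Finset.prod_le_prod (fun i _ => expect_nonneg h0 h1 (hf0 i)) hfe
      _ = _ := by
          rw [Finset.prod_const, ← Real.exp_nat_mul]
          congr 1
          ring
  have hpt : ∀ S, (if (#(s.filter fun i => P i S) : ℝ) < t * #s / 8 then (1 : ℝ) else 0) ≤
      Real.exp (t * #s / 8) * ∏ i ∈ s, f i S := by
    intro S
    split_ifs with h
    · have h2 : ∏ i ∈ s, f i S = (1 / 2) ^ #(s.filter fun i => P i S) := by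
        simp only [hf, Finset.prod_ite, Finset.prod_const, one_pow, mul_one]
      have h3 : Real.exp (-1) ≤ 1 / 2 := by
        rw [Real.exp_neg, inv_eq_one_div]
        exact one_div_le_one_div_of_le (by norm_num) (by linarith [Real.add_one_le_exp 1])
      have h4 : Real.exp (-(t * #s / 8)) ≤ ∏ i ∈ s, f i S := by
        rw [h2]
        calc Real.exp (-(t * #s / 8)) ≤ Real.exp (#(s.filter fun i => P i S) * (-1)) :=
              Real.exp_le_exp.2 (by linarith)
          _ = Real.exp (-1) ^ #(s.filter fun i => P i S) := Real.exp_nat_mul _ _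
          _ ≤ _ := pow_le_pow_left₀ (Real.exp_pos _).le h3 _
      calc (1 : ℝ) = Real.exp (t * #s / 8) * Real.exp (-(t * #s / 8)) := by
            rw [← Real.exp_add, add_neg_cancel, Real.exp_zero]
        _ ≤ _ := mul_le_mul_of_nonneg_left h4 (Real.exp_pos _).le
    · exact mul_nonneg (Real.exp_pos _).le (Finset.prod_nonneg fun i _ => hf0 i S)
  refine (expect_mono h0 h1 hpt).trans ?_
  rw [expect_const_mul]
  refine (mul_le_mul_of_nonneg_left hprod (Real.exp_pos _).le).trans ?_
  rw [← Real.exp_add, Real.exp_le_exp]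
  have : 0 ≤ t * #s := by positivity
  linarith

/-- An upper tail bound for the number of elements of `F` in the random set. -/
theorem expect_lt_card_inter_le {q : E → ℝ} (h0 : ∀ e, 0 ≤ q e) (h1 : ∀ e, q e ≤ 1)
    (F : Finset E) {p t : ℝ} (hq : ∀ e ∈ F, q e ≤ p) :
    expect q (fun S => if t < (#(F ∩ S) : ℝ) then 1 else 0) ≤ Real.exp (p * #F - t / 2) := by
  -- Markov's inequality for 2^N, with N the size of `F ∩ S`; each element of `F` contributes a
  -- factor 1 + q ≤ exp p.
  have hprod : expect q (fun S => ∏ e, if e ∈ S then (if e ∈ F then 2 else 1) else 1) ≤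
      Real.exp (p * #F) := by
    rw [expect_prod_ite q (fun e => if e ∈ F then 2 else 1) (fun _ => 1)]
    rw [← Finset.prod_subset (Finset.subset_univ F)]
    · calc _ ≤ ∏ e ∈ F, Real.exp p := by
            refine Finset.prod_le_prod (fun e he => ?_) fun e he => ?_
            · simp only [he, if_true]; linarith [h0 e]
            · simp only [he, if_true]
              linarith [hq e he, Real.add_one_le_exp p]
        _ = _ := by
            rw [Finset.prod_const, ← Real.exp_nat_mul, mul_comm]
    · intro e _ he
      simp [he]
  have hpt : ∀ S, (if t < (#(F ∩ S) : ℝ) then (1 : ℝ) else 0) ≤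
      Real.exp (-(t / 2)) * ∏ e, if e ∈ S then (if e ∈ F then 2 else 1) else 1 := by
    intro S
    have h2 : (∏ e, if e ∈ S then (if e ∈ F then (2 : ℝ) else 1) else 1) = 2 ^ #(F ∩ S) := by
      rw [← Finset.prod_const, ← Finset.prod_subset (Finset.subset_univ (F ∩ S))]
      · refine Finset.prod_congr rfl fun e he => ?_
        rw [mem_inter] at he
        simp [he]
      · intro e _ he
        rw [mem_inter] at he
        split_ifs <;> tauto
    rw [h2]
    split_ifs with h
    · have h3 : Real.exp (1 / 2) ≤ 2 := by
        have := Real.exp_bound_div_one_sub_of_interval' (x := 1 / 2) (by norm_num) (by norm_num)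
        refine this.le.trans ?_
        norm_num
      calc (1 : ℝ) = Real.exp (-(t / 2)) * Real.exp (t / 2) := by
            rw [← Real.exp_add, neg_add_cancel, Real.exp_zero]
        _ ≤ Real.exp (-(t / 2)) * 2 ^ #(F ∩ S) := by
            refine mul_le_mul_of_nonneg_left ?_ (Real.exp_pos _).le
            calc Real.exp (t / 2) ≤ Real.exp (#(F ∩ S) * (1 / 2)) :=
                  Real.exp_le_exp.2 (by linarith)
              _ = Real.exp (1 / 2) ^ #(F ∩ S) := Real.exp_nat_mul _ _
              _ ≤ _ := pow_le_pow_left₀ (Real.exp_pos _).le h3 _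
    · exact mul_nonneg (Real.exp_pos _).le (by positivity)
  refine (expect_mono h0 h1 hpt).trans ?_
  rw [expect_const_mul, sub_eq_neg_add, Real.exp_add]
  exact mul_le_mul_of_nonneg_left hprod (Real.exp_pos _).le

end Tail

end BernoulliSum

/-! ### Stars: one random vertex meeting several sets and avoiding another. -/

namespace FanGraph

open Finset BernoulliSum

set_option linter.unusedSectionVars false

variable {V : Type*} [Fintype V] [DecidableEq V]

/-- The edges from `v` to the vertices in `B`. -/
def star (v : V) (B : Finset V) : Finset (Sym2 V) := B.image fun w => s(v, w)

theorem mem_star {v w : V} {B : Finset V} : s(v, w) ∈ star v B ↔ w ∈ B := by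
  simp only [star, mem_image, Sym2.congr_right, exists_eq_right]

theorem card_star (v : V) (B : Finset V) : #(star v B) = #B :=
  card_image_of_injective _ fun _ _ h => Sym2.congr_right.1 h

theorem disjoint_star {v : V} {B C : Finset V} (h : Disjoint B C) :
    Disjoint (star v B) (star v C) := by
  rw [Finset.disjoint_left] at h ⊢
  intro e he he'
  obtain ⟨w, hw, rfl⟩ := mem_image.1 he
  exact h hw (mem_star.1 he')

theorem disjoint_star_of_ne {v v' : V} {B B' : Finset V} (h : v ≠ v') (hv : v ∉ B') :
    Disjoint (star v B) (star v' B') := by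
  rw [Finset.disjoint_left]
  intro e he he'
  obtain ⟨w, hw, rfl⟩ := mem_image.1 he
  obtain ⟨w', hw', h'⟩ := mem_image.1 he'
  rcases Sym2.eq_iff.1 h' with ⟨h1, _⟩ | ⟨_, h2⟩
  · exact h h1.symm
  · exact hv (h2 ▸ hw')

theorem expect_disjoint_star (p : ℝ) {v : V} {B : Finset V} (hv : v ∉ B) :
    expect (edgeWeight V p) (fun S => if Disjoint (star v B) S then 1 else 0) =
      (1 - p) ^ #B := by
  rw [expect_disjoint, ← card_star v B, ← Finset.prod_const]
  refine Finset.prod_congr rfl fun e he => ?_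
  obtain ⟨w, hw, rfl⟩ := mem_image.1 he
  rw [edgeWeight_mk (u := v) (v := w) fun h => hv (h ▸ hw)]

theorem dependsOn_disjoint {E : Type*} [Fintype E] [DecidableEq E] {F A : Finset E} (h : F ⊆ A)
    {a b : ℝ} : DependsOn (fun S => if Disjoint F S then a else b) A :=
  dependsOn_of_iff fun S T hST hS => by
    rw [Finset.disjoint_left] at hS ⊢
    exact fun e he heT => hS he ((mem_iff_of_inter_eq hST (h he)).2 heT)

theorem half_le_one_sub_exp {a : ℝ} (h0 : 0 ≤ a) (h1 : a ≤ 1) : a / 2 ≤ 1 - Real.exp (-a) := by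
  have h := Real.add_one_le_exp a
  rw [Real.exp_neg]
  have : (Real.exp a)⁻¹ ≤ (a + 1)⁻¹ := inv_anti₀ (by linarith) h
  have h2 : (a + 1)⁻¹ ≤ 1 - a / 2 := by
    rw [inv_le_iff_one_le_mul₀ (by linarith)]
    nlinarith
  linarith

theorem one_sub_pow_le_exp {p : ℝ} (hp1 : p ≤ 1) (m : ℕ) : (1 - p) ^ m ≤ Real.exp (-(p * m)) := by
  calc (1 - p) ^ m ≤ Real.exp (-p) ^ m :=
        pow_le_pow_left₀ (by linarith) (by linarith [Real.add_one_le_exp (-p)]) _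
    _ = _ := by rw [← Real.exp_nat_mul]; congr 1; ring

/-- The probability that `v` has a neighbour in each of the sets `B u`, but none in `C`. -/
theorem expect_star_ge {p a : ℝ} (hp1 : p ≤ 1) (ha0 : 0 ≤ a) (ha1 : a ≤ 1)
    {X C : Finset V} {B : V → Finset V} {v : V} (hvB : ∀ u ∈ X, v ∉ B u) (hvC : v ∉ C)
    (hB : (X : Set V).PairwiseDisjoint B) (hBC : ∀ u ∈ X, Disjoint (B u) C)
    (hBa : ∀ u ∈ X, a ≤ p * #(B u)) (hC : p * #C ≤ 1 / 2) :
    1 / 2 * (a / 2) ^ #X ≤ expect (edgeWeight V p) (fun S =>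
      if (∀ u ∈ X, ¬ Disjoint (star v (B u)) S) ∧ Disjoint (star v C) S then 1 else 0) := by
  have h : (fun S : Finset (Sym2 V) => if (∀ u ∈ X, ¬ Disjoint (star v (B u)) S) ∧
      Disjoint (star v C) S then (1 : ℝ) else 0) =
      fun S => (if Disjoint (star v C) S then 1 else 0) *
        ∏ u ∈ X, if ¬ Disjoint (star v (B u)) S then 1 else 0 := by
    funext S
    rw [Finset.prod_ite_zero]
    by_cases h1 : Disjoint (star v C) S <;>
      by_cases h2 : ∀ u ∈ X, ¬ Disjoint (star v (B u)) S <;> simp [h1, h2]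
  have hd : ∀ u ∈ X, DependsOn (fun S => if ¬ Disjoint (star v (B u)) S then (1 : ℝ) else 0)
      (star v (B u)) := fun u _ => by
    simp only [ite_not]
    exact dependsOn_disjoint subset_rfl
  rw [h, expect_mul (A := star v C) (B := X.biUnion fun u => star v (B u)), expect_disjoint_star p hvC,
    expect_prod (A := fun u => star v (B u)) X hd]
  · refine mul_le_mul ?_ ?_ (by positivity) (pow_nonneg (by linarith) _)
    · have := one_add_mul_le_pow (a := -p) (by linarith) #C
      rw [← sub_eq_add_neg] at this
      linarith
    · rw [← Finset.prod_const]
      refine Finset.prod_le_prod (fun _ _ => by positivity) fun u hu => ?_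
      rw [expect_indicator_not, expect_disjoint_star p (hvB u hu)]
      have h1 := one_sub_pow_le_exp hp1 #(B u)
      have h2 := half_le_one_sub_exp ha0 ha1
      have h3 : Real.exp (-(p * #(B u))) ≤ Real.exp (-a) :=
        Real.exp_le_exp.2 (neg_le_neg (hBa u hu))
      linarith
  · exact fun u hu u' hu' huu' => disjoint_star (hB hu hu' huu')
  · exact dependsOn_disjoint subset_rfl
  · exact dependsOn_prod fun u hu => (hd u hu).mono
      (Finset.subset_biUnion_of_mem (fun u => star v (B u)) hu)
  · rw [Finset.disjoint_biUnion_right]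
    exact fun u hu => (disjoint_star (hBC u hu)).symm

/-- The probability that no `v ∈ D` has a neighbour in each of the sets `B u`, but none in `C`. -/
theorem expect_forall_not_star_le {p a : ℝ} (hp0 : 0 ≤ p) (hp1 : p ≤ 1) (ha0 : 0 ≤ a)
    (ha1 : a ≤ 1) {X C D : Finset V} {B : V → Finset V} (hDB : ∀ u ∈ X, Disjoint D (B u))
    (hDC : Disjoint D C) (hB : (X : Set V).PairwiseDisjoint B)
    (hBC : ∀ u ∈ X, Disjoint (B u) C) (hBa : ∀ u ∈ X, a ≤ p * #(B u)) (hC : p * #C ≤ 1 / 2) :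
    expect (edgeWeight V p) (fun S => if ∀ v ∈ D,
      ¬ ((∀ u ∈ X, ¬ Disjoint (star v (B u)) S) ∧ Disjoint (star v C) S) then 1 else 0) ≤
      Real.exp (-(1 / 2 * (a / 2) ^ #X * #D)) := by
  -- All relevant pairs at `v` end in `R`, which is disjoint from `D`; so the pairs at different `v`
  -- in `D` are disjoint and the events independent.
  set R := C ∪ X.biUnion B with hR
  have hDR : Disjoint D R := by
    rw [hR, Finset.disjoint_union_right, Finset.disjoint_biUnion_right]
    exact ⟨hDC, hDB⟩
  have hprod : (fun S : Finset (Sym2 V) => if ∀ v ∈ D,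
      ¬ ((∀ u ∈ X, ¬ Disjoint (star v (B u)) S) ∧ Disjoint (star v C) S) then (1 : ℝ) else 0) =
      fun S => ∏ v ∈ D, if ¬ ((∀ u ∈ X, ¬ Disjoint (star v (B u)) S) ∧ Disjoint (star v C) S)
        then 1 else 0 := by
    funext S
    rw [Finset.prod_ite_zero, Finset.prod_const_one]
    congr 1
  rw [hprod, expect_prod (A := fun v => star v R) D]
  · calc _ ≤ ∏ v ∈ D, Real.exp (-(1 / 2 * (a / 2) ^ #X)) := by
          refine Finset.prod_le_prod (fun v _ => expect_nonneg (edgeWeight_nonneg hp0)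
            (fun e => (edgeWeight_le hp0 e).trans hp1) fun S => by split_ifs <;> norm_num)
            fun v hv => ?_
          rw [expect_indicator_not]
          have h1 := expect_star_ge hp1 ha0 ha1
            (fun u hu => Finset.disjoint_left.1 (hDB u hu) hv) (Finset.disjoint_left.1 hDC hv)
            hB hBC hBa hC
          have h2 := Real.add_one_le_exp (-(1 / 2 * (a / 2) ^ #X))
          linarith
      _ = _ := by
          rw [Finset.prod_const, ← Real.exp_nat_mul]
          congr 1
          ring
  · intro v _
    simp only [ite_not]
    have hm : ∀ F, F ⊆ R → ∀ S T : Finset (Sym2 V), S ∩ star v R = T ∩ star v R →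
        (Disjoint (star v F) S ↔ Disjoint (star v F) T) := by
      intro F hF S T hST
      have hsub : star v F ⊆ star v R := image_subset_image hF
      simp only [Finset.disjoint_left]
      exact forall₂_congr fun e he => not_congr (mem_iff_of_inter_eq hST (hsub he))
    refine dependsOn_of_iff fun S T hST h => ⟨fun u hu => ?_, ?_⟩
    · rw [← hm (B u) _ S T hST]
      · exact h.1 u hu
      · exact (Finset.subset_biUnion_of_mem B hu).trans Finset.subset_union_right
    · rw [← hm C Finset.subset_union_left S T hST]
      exact h.2
  · intro v hv v' hv' hne
    exact disjoint_star_of_ne hne (Finset.disjoint_left.1 hDR hv)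

end FanGraph

/-! ### A fixed small set is centered: two rounds of exposure. -/

namespace FanGraph

open Finset BernoulliSum

set_option linter.unusedSectionVars false

variable {V : Type*} [Fintype V] [DecidableEq V]

/-- The pairs with an element in `X`. -/
def incident (X : Finset V) : Finset (Sym2 V) := univ.filter fun e => ∃ u ∈ X, u ∈ e

theorem mk_mem_incident {X : Finset V} {u v : V} : s(u, v) ∈ incident X ↔ u ∈ X ∨ v ∈ X := by
  simp [incident, Sym2.mem_iff]
  constructor
  · rintro ⟨a, ha, rfl | rfl⟩ <;> simp [ha]
  · rintro (h | h)
    · exact ⟨u, h, Or.inl rfl⟩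
    · exact ⟨v, h, Or.inr rfl⟩

/-- The elements of `W` joined to `u` but not to `u'`. -/
def privateNeighbors (S : Finset (Sym2 V)) (W : Finset V) (u u' : V) : Finset V :=
  W.filter fun w => s(w, u) ∈ S ∧ s(w, u') ∉ S

/-- The elements of `D` not joined to any element of `X`. -/
def nonNeighbors (S : Finset (Sym2 V)) (D X : Finset V) : Finset V :=
  D.filter fun v => Disjoint (star v X) S

/-- The vertices outside `X` joined to all of `X`. -/
def dominators (S : Finset (Sym2 V)) (X : Finset V) : Finset V :=
  Xᶜ.filter fun w => ∀ u ∈ X, s(w, u) ∈ S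

/-- `S` decides the pairs meeting `X`, `T` all others. A private neighbour of `u` that `T` joins to
`v` gives the path from `u` to `v`. A neighbour of `v` adjacent to all of `X` lies outside `X`,
hence in `dominators S X`, which `T` does not join to `v`. -/
theorem isCentered_of_star {X D : Finset V} {W : V → Finset V} {τ : V → V}
    (hDX : Disjoint D X) (hWX : ∀ u ∈ X, Disjoint (W u) X) (hDW : ∀ u ∈ X, Disjoint D (W u))
    {S T : Finset (Sym2 V)} {v : V} (hv : v ∈ nonNeighbors S D X)
    (h1 : ∀ u ∈ X, ¬ Disjoint (star v (privateNeighbors S (W u) u (τ u))) T)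
    (h2 : Disjoint (star v (dominators S X)) T) :
    (SimpleGraph.fromEdgeSet
      ((S ∩ incident X ∪ T \ incident X : Finset (Sym2 V)) : Set (Sym2 V))).IsCentered X := by
  have hvX : v ∉ X := Finset.disjoint_left.1 hDX (mem_filter.1 hv).1
  have hvD : v ∈ D := (mem_filter.1 hv).1
  refine ⟨v, ?_, ?_⟩
  · intro u hu
    rw [mem_coe] at hu
    obtain ⟨e, he, heT⟩ := Finset.not_disjoint_iff.1 (h1 u hu)
    obtain ⟨w, hw, rfl⟩ := mem_image.1 he
    obtain ⟨hwW, hwu, _⟩ := mem_filter.1 hw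
    have hwX : w ∉ X := Finset.disjoint_left.1 (hWX u hu) hwW
    have hvw : w ≠ v := fun h => Finset.disjoint_left.1 (hDW u hu) hvD (h ▸ hwW)
    refine ⟨w, mem_coe.not.2 hwX, ?_, ?_⟩
    · rw [SimpleGraph.fromEdgeSet_adj, mem_coe]
      exact ⟨mem_union_left _ (mem_inter.2 ⟨hwu, mk_mem_incident.2 (Or.inr hu)⟩),
        fun h => hwX (h ▸ hu)⟩
    · rw [SimpleGraph.fromEdgeSet_adj, mem_coe]
      refine ⟨mem_union_right _ (Finset.mem_sdiff.2 ⟨Sym2.eq_swap ▸ heT, ?_⟩), hvw⟩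
      rw [mk_mem_incident]
      tauto
  · rintro ⟨w, hwv, hw⟩
    have hwX : w ∉ X := fun h => (hw w (mem_coe.2 h)).ne rfl
    have hwd : w ∈ dominators S X := by
      refine mem_filter.2 ⟨mem_compl.2 hwX, fun u hu => ?_⟩
      have := hw u (mem_coe.2 hu)
      rw [SimpleGraph.fromEdgeSet_adj, mem_coe, mem_union, mem_inter, Finset.mem_sdiff] at this
      rcases this.1 with h | h
      · exact h.1
      · exact absurd (mk_mem_incident.2 (Or.inr hu)) h.2
    rw [SimpleGraph.fromEdgeSet_adj, mem_coe, mem_union, mem_inter, Finset.mem_sdiff,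
      mk_mem_incident] at hwv
    have : s(v, w) ∈ T := Sym2.eq_swap ▸ (by tauto : s(w, v) ∈ T)
    exact Finset.disjoint_left.1 h2 (mem_star.2 hwd) this

/-- Each `w` qualifies with probability p(1 - p) ≥ p/2, independently of the others. -/
theorem expect_card_privateNeighbors_lt_le {p : ℝ} (hp0 : 0 ≤ p) (hp1 : p ≤ 1 / 2) {W : Finset V}
    {u u' : V} (hu : u ∉ W) (hu' : u' ∉ W) (huu' : u ≠ u') :
    expect (edgeWeight V p)
      (fun S => if (#(privateNeighbors S W u u') : ℝ) < p / 2 * #W / 8 then 1 else 0) ≤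
      Real.exp (-(p / 2 * #W / 4)) := by
  refine expect_card_lt_le (edgeWeight_nonneg hp0)
    (fun e => (edgeWeight_le hp0 e).trans (by linarith)) W
    (fun w S => s(w, u) ∈ S ∧ s(w, u') ∉ S) (fun w => star w {u, u'}) ?_ ?_ (by linarith) ?_
  · intro w _ S T hST h
    rwa [← mem_iff_of_inter_eq hST (mem_star.2 (by simp)),
      ← mem_iff_of_inter_eq hST (mem_star.2 (by simp))]
  · intro v hv w hw hvw
    refine disjoint_star_of_ne hvw ?_
    simp only [mem_insert, mem_singleton, not_or]
    exact ⟨fun h => hu (h ▸ hv), fun h => hu' (h ▸ hv)⟩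
  · intro w hw
    have h := expect_subset_disjoint (edgeWeight V p) (F := {s(w, u)}) (H := {s(w, u')})
      (by
        rw [disjoint_singleton_left, mem_singleton, Sym2.congr_right]
        exact huu')
    simp only [singleton_subset_iff, disjoint_singleton_left, prod_singleton] at h
    rw [h, edgeWeight_mk (u := w) (v := u) fun h => hu (h ▸ hw),
      edgeWeight_mk (u := w) (v := u') fun h => hu' (h ▸ hw)]
    nlinarith

theorem expect_card_nonNeighbors_lt_le {p : ℝ} (hp0 : 0 ≤ p) (hp1 : p ≤ 1) {D X : Finset V}
    (hDX : Disjoint D X) (hX : p * #X ≤ 1 / 2) :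
    expect (edgeWeight V p)
      (fun S => if (#(nonNeighbors S D X) : ℝ) < 1 / 2 * #D / 8 then 1 else 0) ≤
      Real.exp (-(1 / 2 * #D / 4)) := by
  refine expect_card_lt_le (edgeWeight_nonneg hp0)
    (fun e => (edgeWeight_le hp0 e).trans hp1) D
    (fun v S => Disjoint (star v X) S) (fun v => star v X) ?_ ?_ (by norm_num) ?_
  · intro v _ S T hST h
    rw [Finset.disjoint_left] at h ⊢
    exact fun e he heT => h he ((mem_iff_of_inter_eq hST he).2 heT)
  · intro v hv w _ hvw
    exact disjoint_star_of_ne hvw (Finset.disjoint_left.1 hDX hv)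
  · intro v hv
    rw [expect_disjoint_star p (Finset.disjoint_left.1 hDX hv)]
    have := one_add_mul_le_pow (a := -p) (by linarith) #X
    rw [← sub_eq_add_neg] at this
    linarith

/-- Dominators are in particular neighbours of the single element `u`, so the tail bound for its
degree is enough. -/
theorem expect_lt_card_dominators_le {p : ℝ} (hp0 : 0 ≤ p) (hp1 : p ≤ 1) {X : Finset V} {t : ℝ}
    {u : V} (hu : u ∈ X) :
    expect (edgeWeight V p) (fun S => if t < (#(dominators S X) : ℝ) then 1 else 0) ≤
      Real.exp (p * Fintype.card V - t / 2) := by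
  have h := expect_lt_card_inter_le (edgeWeight_nonneg hp0)
    (fun e => (edgeWeight_le hp0 e).trans hp1) (star u (univ : Finset V)) (t := t)
    (fun e _ => edgeWeight_le hp0 e)
  rw [card_star, card_univ] at h
  refine le_trans (expect_mono (edgeWeight_nonneg hp0)
    (fun e => (edgeWeight_le hp0 e).trans hp1) fun S => ?_) h
  have hle : #(dominators S X) ≤ #(star u (univ : Finset V) ∩ S) := by
    rw [← card_star u (dominators S X)]
    refine card_le_card fun e he => ?_
    obtain ⟨w, hw, rfl⟩ := mem_image.1 he
    refine mem_inter.2 ⟨mem_star.2 (mem_univ w), ?_⟩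
    rw [Sym2.eq_swap]
    exact (mem_filter.1 hw).2 u hu
  have hle' : (#(dominators S X) : ℝ) ≤ #(star u (univ : Finset V) ∩ S) := by exact_mod_cast hle
  split_ifs with h1 h2
  · exact le_rfl
  · linarith
  · exact zero_le_one
  · exact le_rfl

open Classical in
/-- A bound for the probability that a given set is not centered, given disjoint reservoirs
`W u`, for `u ∈ X`, and `D`. -/
theorem expect_not_isCentered_le_of_reservoirs {p a : ℝ} (hp0 : 0 < p) (hp1 : p ≤ 1 / 2) {L : ℕ}
    {X D : Finset V} {W : V → Finset V} (hXcard : 2 ≤ #X) (hXp : p * #X ≤ 1 / 2)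
    (ha : a = p * (p / 2 * L / 8)) (ha1 : a ≤ 1)
    (hDX : Disjoint D X) (hWX : ∀ u ∈ X, Disjoint (W u) X) (hDW : ∀ u ∈ X, Disjoint D (W u))
    (hW : (X : Set V).PairwiseDisjoint W) (hWL : ∀ u ∈ X, #(W u) = L) (hDL : #D = L) :
    expect (edgeWeight V p) (fun S =>
      if ¬ (SimpleGraph.fromEdgeSet (S : Set (Sym2 V))).IsCentered X then 1 else 0) ≤
      #X * Real.exp (-(p / 2 * L / 4)) + Real.exp (-(1 / 2 * L / 4)) +
        Real.exp (p * Fintype.card V - 1 / (2 * p) / 2) +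
        Real.exp (-(1 / 2 * (a / 2) ^ #X * (1 / 2 * L / 8))) := by
  have hq0 := edgeWeight_nonneg (V := V) hp0.le
  have hq1 : ∀ e, edgeWeight V p e ≤ 1 := fun e => (edgeWeight_le hp0.le e).trans (by linarith)
  have ha0 : 0 ≤ a := by rw [ha]; positivity
  -- Each `u` gets a partner `τ u` in `X`. A vertex not joined to `τ u` is no dominator, which keeps
  -- the private neighbours away from the dominators; this is where two elements are needed.
  have hτ : ∀ u, ∃ u', u' ∈ X ∧ u' ≠ u := fun u => by
    obtain ⟨a, ha, b, hb, hab⟩ := Finset.one_lt_card.1 (show 1 < #X by omega)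
    by_cases h : a = u
    · exact ⟨b, hb, fun h' => hab (h.trans h'.symm)⟩
    · exact ⟨a, ha, h⟩
  choose τ hτX hτne using hτ
  obtain ⟨u₀, hu₀⟩ := Finset.card_pos.1 (show 0 < #X by omega)
  set δ := Real.exp (-(1 / 2 * (a / 2) ^ #X * (1 / 2 * L / 8))) with hδ
  let B : Finset (Sym2 V) → V → Finset V := fun S u => privateNeighbors S (W u) u (τ u)
  -- Second round: when the first round is typical, each available `v` is a centre with probability
  -- at least (1/2)(a/2)^|X|, independently of the others.
  have key : ∀ S : Finset (Sym2 V), (∀ u ∈ X, p / 2 * L / 8 ≤ #(B S u)) →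
      1 / 2 * (L : ℝ) / 8 ≤ #(nonNeighbors S D X) → (#(dominators S X) : ℝ) ≤ 1 / (2 * p) →
      expect (edgeWeight V p) (fun T => if ¬ (SimpleGraph.fromEdgeSet
        ((S ∩ incident X ∪ T \ incident X : Finset (Sym2 V)) : Set (Sym2 V))).IsCentered X
          then 1 else 0) ≤ δ := by
    intro S h1 h2 h3
    refine (expect_mono hq0 hq1 (g := fun T => if ∀ v ∈ nonNeighbors S D X,
      ¬ ((∀ u ∈ X, ¬ Disjoint (star v (B S u)) T) ∧ Disjoint (star v (dominators S X)) T)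
        then 1 else 0) fun T => ?_).trans ((expect_forall_not_star_le (a := a) hp0.le (by linarith)
          ha0 ha1 ?_ ?_ ?_ ?_ ?_ ?_).trans ?_)
    · by_cases h4 : (SimpleGraph.fromEdgeSet
        ((S ∩ incident X ∪ T \ incident X : Finset (Sym2 V)) : Set (Sym2 V))).IsCentered X
      · rw [if_neg (not_not.2 h4)]
        split_ifs <;> norm_num
      · rw [if_pos h4, if_pos]
        exact fun v hv h => h4 (isCentered_of_star hDX hWX hDW hv h.1 h.2)
    · exact fun u hu => (hDW u hu).mono (filter_subset _ _) (filter_subset _ _)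
    -- A vertex joined to no element of the nonempty set `X` cannot dominate it.
    · rw [Finset.disjoint_left]
      intro v hv hv'
      have h4 := (mem_filter.1 hv').2 u₀ hu₀
      exact Finset.disjoint_left.1 (mem_filter.1 hv).2 (mem_star.2 hu₀) h4
    · exact hW.mono fun u => filter_subset _ _
    · intro u hu
      rw [Finset.disjoint_left]
      intro w hw hw'
      exact (mem_filter.1 hw).2.2 ((mem_filter.1 hw').2 _ (hτX u))
    · intro u hu
      rw [ha]
      exact mul_le_mul_of_nonneg_left (h1 u hu) hp0.le
    · calc p * (#(dominators S X) : ℝ) ≤ p * (1 / (2 * p)) :=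
            mul_le_mul_of_nonneg_left h3 hp0.le
        _ = 1 / 2 := by field_simp
    · rw [hδ, Real.exp_le_exp, neg_le_neg_iff]
      exact mul_le_mul_of_nonneg_left h2 (by positivity)
  rw [expect_resample _ (incident X)]
  -- An atypical first round is paid for by one of the indicators, since the conditional probability
  -- is at most 1; a typical one by δ.
  have hpt : ∀ S : Finset (Sym2 V), expect (edgeWeight V p) (fun T =>
      if ¬ (SimpleGraph.fromEdgeSet ((S ∩ incident X ∪ T \ incident X : Finset (Sym2 V)) :
        Set (Sym2 V))).IsCentered X then 1 else 0) ≤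
      (((∑ u ∈ X, if (#(privateNeighbors S (W u) u (τ u)) : ℝ) < p / 2 * #(W u) / 8 then 1 else 0) +
        if (#(nonNeighbors S D X) : ℝ) < 1 / 2 * #D / 8 then 1 else 0) +
        if 1 / (2 * p) < (#(dominators S X) : ℝ) then 1 else 0) + δ := by
    intro S
    have hone : expect (edgeWeight V p) (fun T =>
      if ¬ (SimpleGraph.fromEdgeSet ((S ∩ incident X ∪ T \ incident X : Finset (Sym2 V)) :
        Set (Sym2 V))).IsCentered X then 1 else 0) ≤ 1 := by
      refine (expect_mono hq0 hq1 (g := fun _ => 1) fun T => ?_).trans (BernoulliSum.expect_const _ 1).le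
      split_ifs <;> norm_num
    have hδ0 : 0 ≤ δ := (Real.exp_pos _).le
    have hs0 : ∀ u ∈ X, (0 : ℝ) ≤
        if (#(privateNeighbors S (W u) u (τ u)) : ℝ) < p / 2 * #(W u) / 8 then 1 else 0 :=
      fun u _ => by split_ifs <;> norm_num
    have hs := Finset.sum_nonneg hs0
    by_cases h1 : ∀ u ∈ X, p / 2 * L / 8 ≤ #(B S u)
    · by_cases h2 : 1 / 2 * (L : ℝ) / 8 ≤ #(nonNeighbors S D X)
      · by_cases h3 : (#(dominators S X) : ℝ) ≤ 1 / (2 * p)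
        · refine (key S h1 h2 h3).trans ?_
          rw [hDL, if_neg h2.not_gt, if_neg h3.not_gt]
          linarith
        · refine hone.trans ?_
          rw [if_pos (not_le.1 h3)]
          split_ifs <;> linarith
      · refine hone.trans ?_
        rw [hDL, if_pos (not_le.1 h2)]
        split_ifs <;> linarith
    · push Not at h1
      obtain ⟨u, hu, h1⟩ := h1
      have h5 := Finset.single_le_sum hs0 hu
      rw [hWL u hu, if_pos h1] at h5
      refine hone.trans ?_
      split_ifs <;> linarith
  refine (expect_mono hq0 hq1 hpt).trans ?_
  rw [expect_add, expect_add, expect_add, expect_sum, BernoulliSum.expect_const]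
  refine add_le_add (add_le_add (add_le_add ?_ ?_) ?_) le_rfl
  · rw [← nsmul_eq_mul, ← Finset.sum_const]
    refine Finset.sum_le_sum fun u hu => ?_
    rw [← hWL u hu]
    exact expect_card_privateNeighbors_lt_le hp0.le hp1 (Finset.disjoint_right.1 (hWX u hu) hu)
      (Finset.disjoint_right.1 (hWX u hu) (hτX u)) (hτne u).symm
  · rw [← hDL]
    exact expect_card_nonNeighbors_lt_le hp0.le (by linarith) hDX hXp
  · exact expect_lt_card_dominators_le hp0.le (by linarith) hu₀

/-- The complement of `X` has room for |X| + 1 disjoint blocks of size `L`, indexed by `Option X`: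
`none` gives `D`, the others give the `W u`. -/
theorem exists_reservoirs {X : Finset V} {L : ℕ} (h : (#X + 1) * L + #X ≤ Fintype.card V) :
    ∃ (D : Finset V) (W : V → Finset V), Disjoint D X ∧ (∀ u ∈ X, Disjoint (W u) X) ∧
      (∀ u ∈ X, Disjoint D (W u)) ∧ (X : Set V).PairwiseDisjoint W ∧ (∀ u ∈ X, #(W u) = L) ∧
      #D = L := by
  obtain ⟨f⟩ : Nonempty (Option X × Fin L ↪ (Xᶜ : Finset V)) := by
    refine Function.Embedding.nonempty_of_card_le ?_
    rw [Fintype.card_prod, Fintype.card_option, Fintype.card_coe, Fintype.card_fin,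
      Fintype.card_coe, card_compl]
    omega
  let R : Option X → Finset V := fun o => univ.image fun i => (f (o, i) : V)
  have hRX : ∀ o, Disjoint (R o) X := fun o => by
    rw [Finset.disjoint_left]
    intro w hw
    obtain ⟨i, _, rfl⟩ := mem_image.1 hw
    exact mem_compl.1 (f (o, i)).2
  have hR : ∀ o o', o ≠ o' → Disjoint (R o) (R o') := fun o o' hoo' => by
    rw [Finset.disjoint_left]
    intro w hw hw'
    obtain ⟨i, _, rfl⟩ := mem_image.1 hw
    obtain ⟨j, _, h⟩ := mem_image.1 hw'
    exact hoo' (congrArg Prod.fst (f.injective (Subtype.ext h))).symm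
  have hRL : ∀ o, #(R o) = L := fun o => by
    rw [card_image_of_injective, card_univ, Fintype.card_fin]
    intro i j h
    exact congrArg Prod.snd (f.injective (Subtype.ext h))
  refine ⟨R none, fun u => if hu : u ∈ X then R (some ⟨u, hu⟩) else ∅, hRX _, ?_, ?_, ?_, ?_,
    hRL _⟩
  · intro u hu
    simpa [hu] using hRX (some ⟨u, hu⟩)
  · intro u hu
    simpa [hu] using hR none (some ⟨u, hu⟩) (by simp)
  · intro u hu u' hu' huu'
    rw [mem_coe] at hu hu'
    simpa [Function.onFun, hu, hu'] using hR (some ⟨u, hu⟩) (some ⟨u', hu'⟩) (by simpa using huu')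
  · intro u hu
    simpa [hu] using hRL (some ⟨u, hu⟩)

end FanGraph

/-! ### Asymptotics at the critical exponent. -/

namespace FanGraph

open Finset BernoulliSum

set_option linter.unusedSectionVars false

section Asymptotics

variable {V : Type*} [Fintype V] [DecidableEq V]

set_option maxHeartbeats 1000000 in
/-- The estimates behind the bound for the probability that a given set is not centered, at edge
probability `1 / z ^ (m + 2)` on `z ^ (2 * m + 2)` vertices. -/
theorem reservoir_estimates {m n L : ℕ} (hm : 2 ≤ m) {z p a : ℝ} (hz : 2 * m ≤ z)
    (hn : (n : ℝ) = z ^ (2 * m + 2)) (hp : p = 1 / z ^ (m + 2)) (hL : L = n / (2 * (m + 1)))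
    (ha : a = p * (p / 2 * L / 8)) {c : ℝ} (hc : c = 1 / (128 * ((m : ℝ) + 1)) ^ (m + 1)) :
    p ≤ 1 / 2 ∧ p * m ≤ 1 / 2 ∧ a ≤ 1 ∧ (m + 1) * L + m ≤ n ∧ c * z ≤ p / 2 * L / 4 ∧
      c * z ≤ 1 / 2 * L / 4 ∧ c * z ≤ 1 / (2 * p) / 2 - p * n ∧
      ∀ j ≤ m, c * z ≤ 1 / 2 * (a / 2) ^ j * (1 / 2 * L / 8) := by
  have hm' : (2 : ℝ) ≤ m := by exact_mod_cast hm
  have hz4 : 4 ≤ z := by linarith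
  have hz1 : 1 ≤ z := by linarith
  have hz0 : 0 < z := by linarith
  -- Twice the divisor in `L`: rounding down loses at most a factor 2, so n ≤ K L.
  obtain ⟨K, hK⟩ : ∃ K : ℝ, K = 4 * ((m : ℝ) + 1) := ⟨_, rfl⟩
  have hK12 : 12 ≤ K := by linarith
  have hK0 : 0 < K := by linarith
  have hp0 : 0 < p := by rw [hp]; positivity
  have hz2n : z ^ 2 ≤ z ^ (2 * m + 2) := pow_le_pow_right₀ hz1 (by omega)
  have hn4 : 4 * ((m : ℝ) + 1) ≤ n := by rw [hn]; nlinarith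
  have hn4' : 4 * (m + 1) ≤ n := by exact_mod_cast hn4
  have hL0 : (0 : ℝ) ≤ L := Nat.cast_nonneg _
  have hLn : (L : ℝ) ≤ n := by
    rw [hL]
    exact_mod_cast Nat.div_le_self _ _
  have hLK : (n : ℝ) ≤ K * L := by
    have h1 : n < 2 * (m + 1) * (L + 1) := by
      have := Nat.div_add_mod n (2 * (m + 1))
      have h2 := Nat.mod_lt n (show 0 < 2 * (m + 1) by omega)
      rw [← hL] at this
      nlinarith
    have h3 : n ≤ 4 * (m + 1) * L := by nlinarith
    rw [hK]
    exact_mod_cast h3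
  have hzp : z ^ (m + 2) * p = 1 := by rw [hp]; field_simp
  have hnp : (n : ℝ) * p = z ^ m := by
    rw [hn, show 2 * m + 2 = m + (m + 2) by ring, pow_add, mul_assoc, hzp, mul_one]
  have hnp2 : (n : ℝ) * p ^ 2 = 1 / z ^ 2 := by
    rw [sq, ← mul_assoc, hnp, hp, pow_add]
    field_simp
  have hpz : p ≤ 1 / z ^ 2 := by
    rw [hp]
    exact one_div_le_one_div_of_le (by positivity) (pow_le_pow_right₀ hz1 (by omega))
  have hz2' : 1 / z ^ 2 ≤ 1 / z / 4 := by
    rw [sq, ← div_div]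
    exact div_le_div_of_nonneg_left (by positivity) (by norm_num) hz4
  have hpz' : p * z ≤ 1 / 4 := by
    have : p * z ≤ 1 / z / 4 * z := mul_le_mul_of_nonneg_right (hpz.trans hz2') hz0.le
    rwa [show 1 / z / 4 * z = 1 / 4 by field_simp] at this
  have hp2 : p ≤ 1 / 2 := by nlinarith
  have ha1 : a ≤ 1 := by
    have h1 : a ≤ (n : ℝ) * p ^ 2 := by
      rw [ha]
      nlinarith [mul_le_mul_of_nonneg_right hLn (sq_nonneg p), mul_nonneg (sq_nonneg p) hL0]
    have h2 : 1 / z / 4 ≤ 1 := by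
      rw [div_div]
      exact (div_le_one (by positivity)).2 (by linarith)
    linarith
  have ha0 : 0 ≤ a := by rw [ha]; positivity
  have haK : 1 / (32 * K * z ^ 2) ≤ a / 2 := by
    have h1 : 1 / z ^ 2 ≤ K * L * p ^ 2 := by
      rw [← hnp2]
      exact mul_le_mul_of_nonneg_right hLK (sq_nonneg p)
    calc 1 / (32 * K * z ^ 2) = 1 / (32 * K) * (1 / z ^ 2) := by field_simp
      _ ≤ 1 / (32 * K) * (K * L * p ^ 2) := mul_le_mul_of_nonneg_left h1 (by positivity)
      _ = a / 2 := by rw [ha]; field_simp; ring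
  have hcard : (m + 1) * L + m ≤ n := by
    have h2 : 2 * (m + 1) * L ≤ n := hL ▸ Nat.mul_div_le _ _
    nlinarith
  have h128 : 128 * ((m : ℝ) + 1) = 32 * K := by rw [hK]; ring
  rw [h128] at hc
  have hcK : c ≤ 1 / (32 * K) := by
    rw [hc]
    refine one_div_le_one_div_of_le (by positivity) ?_
    calc 32 * K = (32 * K) ^ 1 := (pow_one _).symm
      _ ≤ _ := pow_le_pow_right₀ (by linarith) (by omega)
  have hc1 : c ≤ 1 := hcK.trans ((div_le_one (by positivity)).2 (by linarith))
  have hc0 : 0 < c := by rw [hc]; positivity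
  have hzm : z ≤ z ^ m := le_self_pow₀ hz1 (by omega)
  have hcz : c * z ≤ 1 / (32 * K) * z ^ m := mul_le_mul hcK hzm hz0.le (by positivity)
  have hpL : z ^ m / K ≤ p * L := by
    rw [div_le_iff₀ (by positivity), ← hnp]
    nlinarith
  have hpLz : c * z ≤ p * L / 8 := by
    have : 1 / (32 * K) * z ^ m ≤ z ^ m / K / 8 := by
      rw [div_div, one_div_mul_eq_div]
      exact div_le_div_of_nonneg_left (by positivity) (by positivity) (by linarith)
    linarith
  have hpLL : p * (L : ℝ) ≤ 1 * L := mul_le_mul_of_nonneg_right (by linarith) hL0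
  refine ⟨hp2, by nlinarith, ha1, hcard, by linarith, by linarith, ?_, ?_⟩
  -- The threshold for dominators is far above the mean degree: 1/(4p) = z^(m+2)/4 ≥ 4 z^m, whereas
  -- pn = z^m.
  · have h1 : 1 / (2 * p) / 2 = z ^ m * z ^ 2 / 4 := by
      rw [← pow_add, ← mul_one (z ^ (m + 2)), ← mul_div_cancel_right₀ 1 hp0.ne', one_mul,
        ← mul_div_assoc, hzp]
      field_simp
      norm_num
    rw [h1, mul_comm p, hnp]
    have h2 : z ^ m * 16 ≤ z ^ m * z ^ 2 := mul_le_mul_of_nonneg_left (by nlinarith) (by positivity)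
    have h3 : c * z ≤ 1 * z := mul_le_mul_of_nonneg_right hc1 hz0.le
    linarith
  · intro j hj
    -- The worst case is j = m, because a/2 ≤ 1. There a/2 is of order z^(-2) and L of order
    -- z^(2m+2), so a factor z² survives; `c` is chosen to make `h3` an identity.
    have h1 : (1 / (32 * K * z ^ 2)) ^ m ≤ (a / 2) ^ j :=
      (pow_le_pow_left₀ (by positivity) haK m).trans
        (pow_le_pow_of_le_one (by linarith) (by linarith) hj)
    have h2 : z ^ (2 * m + 2) / K ≤ L := by
      rw [div_le_iff₀ (by positivity), ← hn]
      linarith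
    have h3 : c * z ^ 2 = (1 / (32 * K * z ^ 2)) ^ m * (z ^ (2 * m + 2) / K / 32) := by
      have e1 : z ^ (2 * m + 2) = (z ^ 2) ^ m * z ^ 2 := by rw [pow_add, pow_mul]
      rw [hc, e1, div_pow, one_pow, mul_pow (32 * K) (z ^ 2), pow_succ (32 * K) m]
      generalize (32 * K) ^ m = A at *
      have hz2 : (z ^ 2) ^ m ≠ 0 := by positivity
      generalize (z ^ 2) ^ m = B at *
      by_cases hA : A = 0
      · simp [hA]
      · field_simp
    calc c * z ≤ c * z ^ 2 := mul_le_mul_of_nonneg_left (le_self_pow₀ hz1 (by omega)) hc0.le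
      _ = (1 / (32 * K * z ^ 2)) ^ m * (z ^ (2 * m + 2) / K / 32) := h3
      _ ≤ (a / 2) ^ j * (L / 32) := mul_le_mul h1 (by linarith) (by positivity) (by positivity)
      _ = _ := by ring

-- All exponents in the reservoir bound are at least c z in absolute value, and it has |X| + 3 ≤ m +
-- 3 terms.
open Classical in
theorem expect_not_isCentered_le {m : ℕ} (hm : 2 ≤ m) {z : ℝ} (hz : 2 * m ≤ z)
    (hV : (Fintype.card V : ℝ) = z ^ (2 * m + 2)) {X : Finset V} (hX2 : 2 ≤ #X) (hXm : #X ≤ m) :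
    expect (edgeWeight V (1 / z ^ (m + 2))) (fun S =>
      if ¬ (SimpleGraph.fromEdgeSet (S : Set (Sym2 V))).IsCentered X then 1 else 0) ≤
      (m + 3) * Real.exp (-(1 / (128 * ((m : ℝ) + 1)) ^ (m + 1) * z)) := by
  have hm' : (2 : ℝ) ≤ m := by exact_mod_cast hm
  have hz0 : 0 < z := by linarith
  obtain ⟨p, hp⟩ : ∃ p : ℝ, p = 1 / z ^ (m + 2) := ⟨_, rfl⟩
  obtain ⟨L, hL⟩ : ∃ L : ℕ, L = Fintype.card V / (2 * (m + 1)) := ⟨_, rfl⟩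
  obtain ⟨a, ha⟩ : ∃ a : ℝ, a = p * (p / 2 * L / 8) := ⟨_, rfl⟩
  obtain ⟨c, hc⟩ : ∃ c : ℝ, c = 1 / (128 * ((m : ℝ) + 1)) ^ (m + 1) := ⟨_, rfl⟩
  obtain ⟨hp2, hpm, ha1, hcard, e1, e2, e3, e4⟩ := reservoir_estimates hm hz hV hp hL ha hc
  have hp0 : 0 < p := by rw [hp]; positivity
  rw [← hp, ← hc]
  have hXm' : (#X : ℝ) ≤ m := by exact_mod_cast hXm
  have hXp : p * #X ≤ 1 / 2 := (mul_le_mul_of_nonneg_left hXm' hp0.le).trans hpm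
  obtain ⟨D, W, hDX, hWX, hDW, hW, hWL, hDL⟩ := exists_reservoirs (X := X) (L := L) (by
    have h1 : (#X + 1) * L ≤ (m + 1) * L := Nat.mul_le_mul_right _ (by omega)
    omega)
  refine (expect_not_isCentered_le_of_reservoirs hp0 hp2 hX2 hXp ha ha1 hDX hWX hDW hW hWL
    hDL).trans ?_
  have f1 : (#X : ℝ) * Real.exp (-(p / 2 * L / 4)) ≤ m * Real.exp (-(c * z)) :=
    mul_le_mul hXm' (Real.exp_le_exp.2 (neg_le_neg e1)) (Real.exp_pos _).le (by positivity)
  have f2 := Real.exp_le_exp.2 (neg_le_neg e2)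
  have f3 : Real.exp (p * Fintype.card V - 1 / (2 * p) / 2) ≤ Real.exp (-(c * z)) :=
    Real.exp_le_exp.2 (by linarith)
  have f4 := Real.exp_le_exp.2 (neg_le_neg (e4 #X hXm))
  linarith

-- A union bound. The nonempty sets of at most `m` elements are enumerated, with repetition, as
-- images of maps `Fin m → V`, of which there are n^m = z^((2m+2)m).
open Classical in
theorem expect_exists_not_isCentered_le {m : ℕ} (hm : 2 ≤ m) {z : ℝ} (hz : 2 * m ≤ z)
    (hV : (Fintype.card V : ℝ) = z ^ (2 * m + 2)) :
    expect (edgeWeight V (1 / z ^ (m + 2))) (fun S =>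
      if ∃ X : Finset V, 2 ≤ #X ∧ #X ≤ m ∧
        ¬ (SimpleGraph.fromEdgeSet (S : Set (Sym2 V))).IsCentered X then 1 else 0) ≤
      (m + 3) * ((z ^ ((2 * m + 2) * m)) *
        Real.exp (-(1 / (128 * ((m : ℝ) + 1)) ^ (m + 1) * z))) := by
  have hm' : (2 : ℝ) ≤ m := by exact_mod_cast hm
  have hz1 : 1 ≤ z := by linarith
  have hz0 : 0 < z := by linarith
  have hp0 : (0 : ℝ) ≤ 1 / z ^ (m + 2) := by positivity
  have hp1 : 1 / z ^ (m + 2) ≤ 1 := (div_le_one (by positivity)).2 (one_le_pow₀ hz1)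
  have hq0 := edgeWeight_nonneg (V := V) hp0
  have hq1 : ∀ e, edgeWeight V (1 / z ^ (m + 2)) e ≤ 1 := fun e => (edgeWeight_le hp0 e).trans hp1
  have hpt : ∀ S : Finset (Sym2 V), (if ∃ X : Finset V, 2 ≤ #X ∧ #X ≤ m ∧
        ¬ (SimpleGraph.fromEdgeSet (S : Set (Sym2 V))).IsCentered X then (1 : ℝ) else 0) ≤
      ∑ f ∈ univ.filter (fun f : Fin m → V => 2 ≤ #(univ.image f)),
        if ¬ (SimpleGraph.fromEdgeSet (S : Set (Sym2 V))).IsCentered (univ.image f : Finset V)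
          then 1 else 0 := by
    intro S
    split_ifs with h
    · obtain ⟨X, hX2, hXm, hX⟩ := h
      obtain ⟨f, rfl⟩ : ∃ f : Fin m → V, univ.image f = X := by
        obtain ⟨x, hx⟩ := Finset.card_pos.1 (show 0 < #X by omega)
        refine ⟨fun i => if h : (i : ℕ) < #X then (X.equivFin.symm ⟨i, h⟩ : V) else x, ?_⟩
        ext v
        simp only [mem_image, mem_univ, true_and]
        constructor
        · rintro ⟨i, rfl⟩
          split_ifs
          · exact (X.equivFin.symm _).2
          · exact hx
        · intro hv
          refine ⟨⟨X.equivFin ⟨v, hv⟩, (X.equivFin ⟨v, hv⟩).2.trans_le hXm⟩, ?_⟩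
          simp
      have h1 := Finset.single_le_sum
        (s := univ.filter (fun f : Fin m → V => 2 ≤ #(univ.image f))) (f := fun f : Fin m → V =>
        if ¬ (SimpleGraph.fromEdgeSet (S : Set (Sym2 V))).IsCentered (univ.image f : Finset V)
          then (1 : ℝ) else 0) (fun f _ => by split_ifs <;> norm_num)
          (mem_filter.2 ⟨mem_univ f, hX2⟩ :
            f ∈ univ.filter (fun f : Fin m → V => 2 ≤ #(univ.image f)))
      simp only [if_pos hX] at h1
      exact h1
    · exact Finset.sum_nonneg fun f _ => by split_ifs <;> norm_num
  refine (expect_mono hq0 hq1 hpt).trans ?_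
  rw [expect_sum]
  refine (Finset.sum_le_sum fun f hf => expect_not_isCentered_le hm hz hV (mem_filter.1 hf).2
    (card_image_le.trans (by simp))).trans ?_
  rw [Finset.sum_const, nsmul_eq_mul]
  have hcard : (#(univ.filter fun f : Fin m → V => 2 ≤ #(univ.image f)) : ℝ) ≤
      z ^ ((2 * m + 2) * m) := by
    have h1 : #(univ.filter fun f : Fin m → V => 2 ≤ #(univ.image f)) ≤ Fintype.card V ^ m :=
      (card_filter_le _ _).trans (by simp)
    calc _ ≤ ((Fintype.card V ^ m : ℕ) : ℝ) := by exact_mod_cast h1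
      _ = _ := by rw [Nat.cast_pow, hV, pow_mul]
  rw [mul_left_comm]
  exact mul_le_mul_of_nonneg_left (mul_le_mul_of_nonneg_right hcard (Real.exp_pos _).le)
    (by positivity)

open Classical in
/-- The probability that there is a fan set that is not centered is bounded away from `1`. -/
theorem expect_exists_isFanSet_le {k : ℕ} {z : ℝ} (hz : 2 * ((k + 2 : ℕ) : ℝ) ≤ z)
    (hV : (Fintype.card V : ℝ) = z ^ (2 * (k + 2) + 2)) :
    expect (edgeWeight V (1 / z ^ (k + 2 + 2))) (fun S => if ∃ X : Set V,
      (SimpleGraph.fromEdgeSet (S : Set (Sym2 V))).IsFanSet X ∧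
        ¬ (SimpleGraph.fromEdgeSet (S : Set (Sym2 V))).IsCentered X then 1 else 0) ≤
      (((k + 2 : ℕ) : ℝ) + 3) * ((z ^ ((2 * (k + 2) + 2) * (k + 2))) *
        Real.exp (-(1 / (128 * (((k + 2 : ℕ) : ℝ) + 1)) ^ (k + 2 + 1) * z))) + 1 / 2 := by
  have hk : (0 : ℝ) ≤ k := Nat.cast_nonneg k
  have hz1 : 1 ≤ z := by push_cast at hz; linarith
  have hz0 : 0 < z := by linarith
  have hp0 : (0 : ℝ) ≤ 1 / z ^ (k + 2 + 2) := by positivity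
  have hp1 : 1 / z ^ (k + 2 + 2) ≤ 1 := (div_le_one (by positivity)).2 (one_le_pow₀ hz1)
  have hr : (Fintype.card V : ℝ) ^ (k + 4) * (1 / z ^ (k + 2 + 2)) ^ (2 * (k + 3)) ≤ 1 := by
    rw [hV, div_pow, one_pow, ← pow_mul, ← pow_mul, mul_one_div]
    refine (div_le_one (by positivity)).2 (le_of_eq ?_)
    congr 1
    ring
  refine le_trans (expect_mono (edgeWeight_nonneg hp0)
    (fun e => (edgeWeight_le hp0 e).trans hp1) (g := fun S =>
      (if ∃ X : Finset V, 2 ≤ #X ∧ #X ≤ k + 2 ∧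
        ¬ (SimpleGraph.fromEdgeSet (S : Set (Sym2 V))).IsCentered X then 1 else 0) +
      if ∃ g : Vertex k ↪ V, edges g ⊆ S then 1 else 0) fun S => ?_) ?_
  · have n1 : (0 : ℝ) ≤ if ∃ X : Finset V, 2 ≤ #X ∧ #X ≤ k + 2 ∧
        ¬ (SimpleGraph.fromEdgeSet (S : Set (Sym2 V))).IsCentered X then 1 else 0 := by
      split_ifs <;> norm_num
    have n2 : (0 : ℝ) ≤ if ∃ g : Vertex k ↪ V, edges g ⊆ S then 1 else 0 := by
      split_ifs <;> norm_num
    by_cases h : ∃ X : Set V, (SimpleGraph.fromEdgeSet (S : Set (Sym2 V))).IsFanSet X ∧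
        ¬ (SimpleGraph.fromEdgeSet (S : Set (Sym2 V))).IsCentered X
    · rw [if_pos h]
      obtain ⟨X, hX, hXc⟩ := h
      rw [← Set.coe_toFinset X] at hX hXc
      by_cases hXk : #X.toFinset ≤ k + 2
      · have h2 : ∃ X : Finset V, 2 ≤ #X ∧ #X ≤ k + 2 ∧
            ¬ (SimpleGraph.fromEdgeSet (S : Set (Sym2 V))).IsCentered X := by
          obtain ⟨_, _, a, b, c, ha, hb, _, hab, _⟩ := hX
          exact ⟨X.toFinset, Finset.one_lt_card.2 ⟨a, mem_coe.1 ha, b, mem_coe.1 hb, hab.ne⟩,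
            hXk, hXc⟩
        rw [if_pos h2]
        linarith
      · have h2 : ∃ g : Vertex k ↪ V, edges g ⊆ S := by
          obtain ⟨g, hg⟩ := exists_embedding_of_isFanSet (k := k) hX
            (by rw [Set.ncard_coe_finset]; omega)
          refine ⟨g, fun e he => ?_⟩
          obtain ⟨⟨i, j⟩, hij, rfl⟩ := mem_image.1 he
          have := hg i j (mem_arcs.1 hij)
          rw [SimpleGraph.fromEdgeSet_adj] at this
          exact mem_coe.1 this.1
        rw [if_pos h2]
        linarith
    · rw [if_neg h]
      linarith
  · rw [expect_add]
    exact add_le_add (expect_exists_not_isCentered_le (by omega) hz hV)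
      (expect_exists_copy_le hp0 hp1 hr)

open Classical in
/-- The probability that there is a fan set that is not centered is bounded away from `0`. -/
theorem expect_exists_isFanSet_ge {k : ℕ} {z : ℝ} (hz : 2 * ((k : ℝ) + 4) ≤ z)
    (hV : (Fintype.card V : ℝ) = z ^ (2 * (k + 2) + 2)) :
    (Real.exp (-(2 * (k + 4) ^ (k + 3))) / 2) ^ 2 / (2 ^ (k + 4) * (k + 4) ^ (k + 4)) ≤
    expect (edgeWeight V (1 / z ^ (k + 2 + 2))) (fun S => if ∃ X : Set V,
      (SimpleGraph.fromEdgeSet (S : Set (Sym2 V))).IsFanSet X ∧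
        ¬ (SimpleGraph.fromEdgeSet (S : Set (Sym2 V))).IsCentered X then 1 else 0) := by
  have hk : (0 : ℝ) ≤ k := Nat.cast_nonneg k
  have hz2 : 2 ≤ z := by linarith
  have hz1 : 1 ≤ z := by linarith
  have hz0 : 0 < z := by linarith
  have hp0 : (0 : ℝ) ≤ 1 / z ^ (k + 2 + 2) := by positivity
  have hp1 : 1 / z ^ (k + 2 + 2) ≤ 1 / 2 :=
    one_div_le_one_div_of_le (by norm_num) (hz2.trans (le_self_pow₀ hz1 (by omega)))
  have hr : (Fintype.card V : ℝ) ^ (k + 4) * (1 / z ^ (k + 2 + 2)) ^ (2 * (k + 3)) = 1 := by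
    rw [hV, div_pow, one_pow, ← pow_mul, ← pow_mul, mul_one_div]
    rw [div_eq_one_iff_eq (by positivity)]
    congr 1
    ring
  have hnp : 1 ≤ (Fintype.card V : ℝ) * (1 / z ^ (k + 2 + 2)) := by
    rw [hV, mul_one_div, one_le_div (by positivity)]
    exact pow_le_pow_right₀ hz1 (by omega)
  have hnp2 : (Fintype.card V : ℝ) * (1 / z ^ (k + 2 + 2)) ^ 2 ≤ 1 := by
    rw [hV, div_pow, one_pow, ← pow_mul, mul_one_div]
    refine (div_le_one (by positivity)).2 (pow_le_pow_right₀ hz1 (by omega))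
  have hnz : z ^ 2 ≤ Fintype.card V := by
    rw [hV]
    exact pow_le_pow_right₀ hz1 (by omega)
  have hcard : 1 / 2 ≤ (Fintype.card (Vertex k ↪ V) : ℝ) *
      (1 / z ^ (k + 2 + 2)) ^ (2 * (k + 3)) := by
    have hn : ((k : ℝ) + 4) * (2 * (k + 4)) ≤ Fintype.card V := by nlinarith
    have hn0 : (0 : ℝ) < Fintype.card V := lt_of_lt_of_le (by positivity) hn
    have hkn : k + 4 ≤ Fintype.card V := by
      have : (k : ℝ) + 4 ≤ Fintype.card V := by nlinarith
      exact_mod_cast this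
    have h1 : (Fintype.card V - (k + 4)) ^ (k + 4) ≤ Fintype.card (Vertex k ↪ V) := by
      rw [Fintype.card_embedding_eq, Fintype.card_sum, Fintype.card_fin, Fintype.card_fin,
        add_comm 4 k]
      exact (Nat.pow_le_pow_left (by omega) _).trans (Nat.pow_sub_le_descFactorial _ _)
    have h2 : ((Fintype.card V : ℝ) - (k + 4)) ^ (k + 4) ≤ Fintype.card (Vertex k ↪ V) := by
      have : (((Fintype.card V - (k + 4)) ^ (k + 4) : ℕ) : ℝ) ≤ Fintype.card (Vertex k ↪ V) := by
        exact_mod_cast h1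
      rw [Nat.cast_pow, Nat.cast_sub hkn] at this
      push_cast at this
      exact this
    -- Bernoulli's inequality: requiring injectivity costs at most half of the n^(k+4) maps once n ≥
    -- 2(k+4)².
    have h3 : 1 / 2 ≤ (1 + -(((k : ℝ) + 4) / Fintype.card V)) ^ (k + 4) := by
      have hle : ((k : ℝ) + 4) * (((k : ℝ) + 4) / Fintype.card V) ≤ 1 / 2 := by
        rw [← mul_div_assoc, div_le_iff₀ hn0]
        linarith
      have h5 : 0 ≤ ((k : ℝ) + 4) / Fintype.card V := by positivity
      have h4 := one_add_mul_le_pow (a := -(((k : ℝ) + 4) / Fintype.card V)) (by nlinarith) (k + 4)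
      push_cast at h4
      linarith
    have h6 : (Fintype.card V : ℝ) - (k + 4) =
        Fintype.card V * (1 + -(((k : ℝ) + 4) / Fintype.card V)) := by
      field_simp
      ring
    calc (1 : ℝ) / 2 ≤ ((Fintype.card V : ℝ) ^ (k + 4) *
            (1 / z ^ (k + 2 + 2)) ^ (2 * (k + 3))) *
              (1 + -(((k : ℝ) + 4) / Fintype.card V)) ^ (k + 4) := by
          rw [hr, one_mul]; exact h3
      _ = ((Fintype.card V : ℝ) - (k + 4)) ^ (k + 4) *
            (1 / z ^ (k + 2 + 2)) ^ (2 * (k + 3)) := by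
          rw [h6, mul_pow, mul_right_comm]
      _ ≤ _ := mul_le_mul_of_nonneg_right h2 (by positivity)
  refine (expect_exists_copy_not_detour_ge hp0 hp1 hnp hnp2 hr.le hcard).trans
    (expect_mono (edgeWeight_nonneg hp0) (fun e => (edgeWeight_le hp0 e).trans (by linarith))
      fun S => ?_)
  by_cases h : ∃ g : Vertex k ↪ V, edges g ⊆ S ∧ ∀ x ∈ detourIndex g, ¬ detour g x.1 x.2 ⊆ S
  · obtain ⟨g, hg, hS⟩ := h
    rw [if_pos ⟨g, hg, hS⟩, if_pos (isFanSet_and_not_isCentered hg hS)]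
  · rw [if_neg h]
    split_ifs <;> norm_num

end Asymptotics

open Classical in
theorem prob_fanSentence_eq {α : ℝ} (hα : 0 < α) (n : ℕ) :
    MSOFormula.fanSentence.prob α n =
      expect (edgeWeight (Fin n) ((n : ℝ) ^ (-α))) (fun S => if ∃ X : Set (Fin n),
        (SimpleGraph.fromEdgeSet (S : Set (Sym2 (Fin n)))).IsFanSet X ∧
          ¬ (SimpleGraph.fromEdgeSet (S : Set (Sym2 (Fin n)))).IsCentered X then 1 else 0) := by
  unfold MSOFormula.prob
  simp only [MSOFormula.models_fanSentence]
  rw [← coe_edgeProb hα]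
  refine (binomialRandom_real_eq_expect (edgeProb α n)
    (fun G => ∃ X : Set (Fin n), G.IsFanSet X ∧ ¬ G.IsCentered X)).trans ?_
  congr!

theorem mem_spectrum_fanSentence (k : ℕ) :
    1 / 2 + 1 / (2 * (((k + 2 : ℕ) : ℝ) + 1)) ∈ MSOFormula.fanSentence.spectrum := by
  classical
  set α : ℝ := 1 / 2 + 1 / (2 * (((k + 2 : ℕ) : ℝ) + 1)) with hα
  have hα0 : 0 < α := by positivity
  -- With this root of n both n and n^(-α) are integral powers of z, as α(2m+2) = m + 2 for m = k +
  -- 2.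
  let z : ℕ → ℝ := fun n => (n : ℝ) ^ ((2 * (k + 2) + 2 : ℕ) : ℝ)⁻¹
  have hz : Tendsto z atTop atTop :=
    (tendsto_rpow_atTop (by positivity)).comp tendsto_natCast_atTop_atTop
  have hzn : ∀ n : ℕ, (Fintype.card (Fin n) : ℝ) = z n ^ (2 * (k + 2) + 2) := fun n => by
    rw [Fintype.card_fin, Real.rpow_inv_natCast_pow (Nat.cast_nonneg n) (by omega)]
  have hzp : ∀ n : ℕ, (n : ℝ) ^ (-α) = 1 / z n ^ (k + 2 + 2) := fun n => by
    rw [Real.rpow_neg (Nat.cast_nonneg n), one_div, ← Real.rpow_natCast (z n),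
      ← Real.rpow_mul (Nat.cast_nonneg n)]
    congr 2
    rw [hα]
    push_cast
    field_simp
    ring
  refine ⟨hα0, ?_⟩
  rintro (h | h)
  · set c : ℝ := (Real.exp (-(2 * ((k : ℝ) + 4) ^ (k + 3))) / 2) ^ 2 /
      (2 ^ (k + 4) * (k + 4) ^ (k + 4)) with hc
    have hc0 : 0 < c := by positivity
    have hev : ∀ᶠ n in atTop, c ≤ MSOFormula.fanSentence.prob α n := by
      filter_upwards [hz.eventually_ge_atTop (2 * ((k : ℝ) + 4))] with n hn
      rw [prob_fanSentence_eq hα0, hzp]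
      exact expect_exists_isFanSet_ge hn (hzn n)
    exact absurd (ge_of_tendsto h hev) (not_le.2 hc0)
  · have hlim : Tendsto (fun n => (((k + 2 : ℕ) : ℝ) + 3) *
        (((z n) ^ ((2 * (k + 2) + 2) * (k + 2))) *
        Real.exp (-(1 / (128 * (((k + 2 : ℕ) : ℝ) + 1)) ^ (k + 2 + 1) * z n))) + 1 / 2)
        atTop (𝓝 (1 / 2)) := by
      have h1 := (tendsto_rpow_mul_exp_neg_mul_atTop_nhds_zero
        (((2 * (k + 2) + 2) * (k + 2) : ℕ) : ℝ)
        (1 / (128 * (((k + 2 : ℕ) : ℝ) + 1)) ^ (k + 2 + 1)) (by positivity)).comp hz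
      have h2 := (h1.const_mul (((k + 2 : ℕ) : ℝ) + 3)).add_const (1 / 2)
      rw [mul_zero, zero_add] at h2
      refine h2.congr fun n => ?_
      simp only [Function.comp, Real.rpow_natCast, neg_mul]
    -- The exponential beats the power of z from the union bound, so only the 1/2 for copies of the
    -- fan graph remains in the limit.
    have hle : (1 : ℝ) ≤ 1 / 2 := by
      refine le_of_tendsto_of_tendsto h hlim ?_
      filter_upwards [hz.eventually_ge_atTop (2 * ((k + 2 : ℕ) : ℝ))] with n hn
      rw [prob_fanSentence_eq hα0, hzp]
      exact expect_exists_isFanSet_le hn (hzn n)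
    norm_num at hle

end FanGraph

theorem theorem3 :
    ∃ φ : MSOSentence, φ.quantifierDepth = 4 ∧ φ.spectrum.Infinite ∧
      ∀ m : ℕ, 2 ≤ m → (1 / 2 + 1 / (2 * ((m : ℝ) + 1))) ∈ φ.spectrum := by
  refine ⟨MSOFormula.fanSentence, MSOFormula.quantifierDepth_fanSentence, ?_, ?_⟩
  · refine Set.infinite_of_injective_forall_mem
      (f := fun k : ℕ => (1 / 2 + 1 / (2 * (((k + 2 : ℕ) : ℝ) + 1)) : ℝ)) ?_
      FanGraph.mem_spectrum_fanSentence
    intro a b hab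
    have h := add_left_cancel hab
    rw [div_eq_div_iff (by positivity) (by positivity)] at h
    push_cast at h
    have : (a : ℝ) = b := by linarith
    exact_mod_cast this
  · intro m hm
    obtain ⟨k, rfl⟩ := Nat.exists_eq_add_of_le' hm
    exact FanGraph.mem_spectrum_fanSentence k
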